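/- **Theorem.** Let $M$ be an $n$-dimensional $C^\infty$ manifold, $g$ a $C^\infty$ semi-Riemann metric on $M$ (a smooth symmetric nondegenerate $(0,2)$-tensor field of constant signature) with Levi-Civita connection $\nabla$ and Christoffel symbols $\Gamma^i_{jk}$, and $X$ a $C^\infty$ vector field on $M$. Put $f=\tfrac12 g(X,X)$, let $F$ be the $(1,1)$-tensor field $F_j{}^i=\nabla_jX^i-g^{ih}g_{kj}\nabla_hX^k$, and let $\omega=g\circ F$ be the 2-form $\omega(u,v)=g(Fu,v)$, that is $\omega_{ij}=g_{jh}F_i{}^h$. Consider the dynamical system $$\frac{\nabla}{dt}\frac{dx}{dt}=\operatorname{grad} f+F\Big(\frac{dx}{dt}\Big).\tag{3''}$$ For each chart $(x^i)$ of $M$ let $(x^i,y^i)$ be the induced coordinates on $TM$ and $\delta y^j=dy^j+\Gamma^j_{hk}y^k\,dx^h$. Then the local expressions $$\Omega_2=\tfrac12\,\omega_{ij}\,dx^i\wedge dx^j+g_{ij}\,dx^i\wedge\delta y^j,\qquad \eta_2=-g_{ij}X^i\,dx^j+g_{ij}y^i\,dx^j$$ do not depend on the chart and define smooth forms on $TM$;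 $\Omega_2=-d\eta_2$; and $\Omega_2$ is a symplectic (closed, nondegenerate) form on $TM$. The function $H(x,y)=\tfrac12 g(y,y)-f(x)$ on $TM$ is smooth, and there is a unique vector field $X_H$ on $TM$ with $\Omega_2(X_H,\cdot)=dH$; it is smooth. The system (3'') lifts to $TM$ as the Hamilton system of $H$ with respect to $\Omega_2$: on every open set of times, a curve $c$ in $M$ is a ($C^2$) solution of (3'') if and only if its velocity lift $t\mapsto(c(t),\dot c(t))$ is an integral curve of $X_H$, and every integral curve of $X_H$ is the velocity lift of its projection to $M$, which is a solution of (3''). -/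

import Mathlib

open scoped Manifold ContDiff
open Bundle

noncomputable section

namespace GeomDyn

/-! ## Differential forms on a manifold without boundary -/

section Forms

variable {F : Type*} [NormedAddCommGroup F] [NormedSpace ℝ F] {H : Type*} [TopologicalSpace H]
  (J : ModelWithCorners ℝ F H) {N : Type*} [TopologicalSpace N] [ChartedSpace H N]

/-- A (not necessarily continuous) differential form of degree `k` on `N`. -/
abbrev DiffForm (N : Type*) [TopologicalSpace N] [ChartedSpace H N] (k : ℕ) : Type _ :=
  (p : N) → (TangentSpace J p) [⋀^Fin k]→L[ℝ] ℝ

/-- The form `α` written in the chart at `q`: its pullback under the inverse of that chart,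
a form on the model vector space (meaningful on the target of the chart). -/
def formInChart {k : ℕ} (α : DiffForm J N k) (q : N) (z : F) : F [⋀^Fin k]→L[ℝ] ℝ :=
  (α ((extChartAt J q).symm z)).compContinuousLinearMap
    (mfderiv 𝓘(ℝ, F) J (extChartAt J q).symm z)

/-- A form is smooth if it is smooth in every chart of a covering family. -/
def IsSmoothForm {k : ℕ} (α : DiffForm J N k) : Prop :=
  ∀ q : N, ContDiffOn ℝ ∞ (formInChart J α q) (extChartAt J q).target

/-- The exterior derivative of a form on a manifold without boundary: at `p` it is the exterior
derivative of the form written in the chart at `p`, pulled back by this chart. -/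
def extDerivForm {k : ℕ} (α : DiffForm J N k) : DiffForm J N (k + 1) := fun p ↦
  (extDeriv (formInChart J α p) (extChartAt J p p)).compContinuousLinearMap
    (mfderiv J 𝓘(ℝ, F) (extChartAt J p) p)

/-- A symplectic form: a smooth, closed, nondegenerate 2-form. -/
structure IsSymplectic (Ω : DiffForm J N 2) : Prop where
  smooth : IsSmoothForm J Ω
  closed : ∀ p, extDerivForm J Ω p = 0
  nondegenerate : ∀ (p : N) (v : TangentSpace J p), (∀ w : TangentSpace J p, Ω p ![v, w] = 0) → v = 0

/-- `V` is the Hamilton gradient of `h` with respect to `Ω`: `Ω (V, w) = dh (w)` for all `w`. -/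
def IsHamiltonGradient (Ω : DiffForm J N 2) (h : N → ℝ) (V : (p : N) → TangentSpace J p) : Prop :=
  ∀ (p : N) (w : TangentSpace J p), Ω p ![V p, w] = (mfderiv J 𝓘(ℝ, ℝ) h p w : ℝ)

end Forms

section Algebra

variable {T : Type*} [AddCommGroup T] [Module ℝ T] [TopologicalSpace T]

/-- The wedge product of two covectors, `(a ∧ b)(v, w) = a(v) b(w) - a(w) b(v)`. -/
def wedge (a b : T →L[ℝ] ℝ) : T [⋀^Fin 2]→L[ℝ] ℝ where
  toFun v := a (v 0) * b (v 1) - a (v 1) * b (v 0)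
  map_update_add' v i x y := by
    fin_cases i <;> simp [Function.update] <;> ring
  map_update_smul' v i c x := by
    fin_cases i <;> simp [Function.update] <;> ring
  cont := by fun_prop
  map_eq_zero_of_eq' v i j h hij := by
    fin_cases i <;> fin_cases j <;> simp_all

/-- A covector seen as an alternating form of degree one. -/
def oneForm (a : T →L[ℝ] ℝ) : T [⋀^Fin 1]→L[ℝ] ℝ :=
  ContinuousAlternatingMap.ofSubsingleton ℝ T ℝ (0 : Fin 1) a

end Algebra

/-! ## Semi-Riemann manifolds in coordinates -/

/-- The model space `ℝⁿ`. -/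
abbrev Vec (n : ℕ) : Type := EuclideanSpace ℝ (Fin n)

/-- The vector `e_i` of the standard basis of `ℝⁿ`. -/
abbrev stdVec {n : ℕ} (i : Fin n) : Vec n := EuclideanSpace.single i (1 : ℝ)

/-- A semi-Riemann metric on an `n`-dimensional manifold: a smooth symmetric nondegenerate tensor
field of type (0,2), with the same signature `(r, s)` at all points. -/
structure SemiRiemannMetric (n : ℕ) (M : Type*) [TopologicalSpace M] [ChartedSpace (Vec n) M]
    [IsManifold (𝓡 n) ∞ M] where
  /-- The inner product on each tangent space. -/
  inner (x : M) : TangentSpace (𝓡 n) x →L[ℝ] TangentSpace (𝓡 n) x →L[ℝ] ℝ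
  symm (x : M) (v w : TangentSpace (𝓡 n) x) : inner x v w = inner x w v
  nondegenerate (x : M) (v : TangentSpace (𝓡 n) x) : (∀ w, inner x v w = 0) → v = 0
  signature : ∃ r s : ℕ, ∀ x : M, ∃ b : Module.Basis (Fin r ⊕ Fin s) ℝ (TangentSpace (𝓡 n) x),
    ∀ a c, inner x (b a) (b c) =
      if a = c then Sum.elim (fun _ ↦ (1 : ℝ)) (fun _ ↦ (-1 : ℝ)) a else 0
  contMDiff : ContMDiff (𝓡 n) ((𝓡 n).prod 𝓘(ℝ, Vec n →L[ℝ] Vec n →L[ℝ] ℝ)) ∞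
    (fun x ↦ TotalSpace.mk' (Vec n →L[ℝ] Vec n →L[ℝ] ℝ) x (inner x))

section Coordinates

variable {n : ℕ} {M : Type*} [TopologicalSpace M] [ChartedSpace (Vec n) M]

/-- The coordinate vector field `∂_i` of the chart `φ`, at the point with coordinates `z`. -/
def coordField (φ : OpenPartialHomeomorph M (Vec n)) (i : Fin n) (z : Vec n) :
    TangentSpace (𝓡 n) (φ.symm z) :=
  mfderiv (𝓡 n) (𝓡 n) φ.symm z (stdVec i)

/-- The components `v^i` in the chart `φ` of a tangent vector `v` at `x`. -/
def comp (φ : OpenPartialHomeomorph M (Vec n)) (x : M) (v : TangentSpace (𝓡 n) x) : Vec n :=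
  mfderiv (𝓡 n) (𝓡 n) φ x v

/-- The partial derivative `∂u/∂x^i` of a function of the coordinates. -/
def pd (i : Fin n) (u : Vec n → ℝ) (z : Vec n) : ℝ := fderiv ℝ u z (stdVec i)

variable [IsManifold (𝓡 n) ∞ M] (g : SemiRiemannMetric n M)
  (X : (x : M) → TangentSpace (𝓡 n) x) (φ : OpenPartialHomeomorph M (Vec n))

/-- The components `g_{ij}`. -/
def gLow (i j : Fin n) (z : Vec n) : ℝ :=
  g.inner (φ.symm z) (coordField φ i z) (coordField φ j z)

/-- The components `g^{ij}` of the inverse matrix. -/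
def gUp (i j : Fin n) (z : Vec n) : ℝ :=
  (Matrix.of fun a b ↦ gLow g φ a b z)⁻¹ i j

/-- The components `X^i` of the vector field `X`. -/
def XUp (i : Fin n) (z : Vec n) : ℝ := comp φ (φ.symm z) (X (φ.symm z)) i

/-- The components `Γ^i_{jk}` of the Levi-Civita connection. -/
def Gam (i j k : Fin n) (z : Vec n) : ℝ :=
  (1 / 2) * ∑ l, gUp g φ i l z *
    (pd j (gLow g φ l k) z + pd k (gLow g φ l j) z - pd l (gLow g φ j k) z)

/-- The components `∇_j X^i` of the covariant derivative of `X`. -/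
def nablaX (j i : Fin n) (z : Vec n) : ℝ :=
  pd j (XUp X φ i) z + ∑ k, Gam g φ i j k z * XUp X φ k z

/-- The components `F_j^i = ∇_j X^i - g^{ih} g_{kj} ∇_h X^k` of the tensor field `F`. -/
def Fmix (j i : Fin n) (z : Vec n) : ℝ :=
  nablaX g X φ j i z - ∑ h, ∑ k, gUp g φ i h z * gLow g φ k j z * nablaX g X φ h k z

/-- The components `ω_{ij} = g_{jh} F_i^h`, that is `ω (u, v) = g (F u, v)`. -/
def omegaLow (i j : Fin n) (z : Vec n) : ℝ := ∑ h, gLow g φ j h z * Fmix g X φ i h z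

/-- The energy `f = g(X, X) / 2`. -/
def energy (x : M) : ℝ := (1 / 2) * g.inner x (X x) (X x)

/-- The components `(grad f)^i = g^{ij} ∂f/∂x^j`. -/
def gradEnergy (i : Fin n) (z : Vec n) : ℝ :=
  ∑ j, gUp g φ i j z * pd j (fun w ↦ energy g X (φ.symm w)) z

/-- The system `∇/dt (dx/dt) = grad f + F (dx/dt)` for the curve `c` at time `t`, in the chart `φ`:
`(x^i)'' + Γ^i_{jk} (x^j)' (x^k)' = (grad f)^i + F_j^i (x^j)'`. -/
def SystemInChart (c : ℝ → M) (t : ℝ) : Prop :=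
  let x' : Fin n → ℝ → ℝ := fun i ↦ deriv (fun s ↦ φ (c s) i)
  ∀ i, deriv (x' i) t + ∑ j, ∑ k, Gam g φ i j k (φ (c t)) * x' j t * x' k t =
    gradEnergy g X φ i (φ (c t)) + ∑ j, Fmix g X φ j i (φ (c t)) * x' j t

/-- `c` is a trajectory on the set `s` of times of the system
`∇/dt (dx/dt) = grad f + F (dx/dt)`. -/
def IsTrajectoryOn (c : ℝ → M) (s : Set ℝ) : Prop :=
  ContMDiffOn 𝓘(ℝ, ℝ) (𝓡 n) 2 c s ∧
    ∀ t ∈ s, ∀ φ ∈ IsManifold.maximalAtlas (𝓡 n) ∞ M, c t ∈ φ.source → SystemInChart g X φ c t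

/-! ## The tangent bundle -/

/-- The canonical lift `t ↦ (c t, c' t)` of a curve to the tangent bundle. -/
def velocityLift (c : ℝ → M) (t : ℝ) : TangentBundle (𝓡 n) M :=
  ⟨c t, mfderiv 𝓘(ℝ, ℝ) (𝓡 n) c t (1 : ℝ)⟩

/-- The Hamiltonian `H (x, y) = g(y, y) / 2 - f(x)` on the tangent bundle. -/
def hamiltonian (p : TangentBundle (𝓡 n) M) : ℝ :=
  (1 / 2) * g.inner p.proj p.snd p.snd - energy g X p.proj

/-- The induced coordinate `y^i` on the tangent bundle. -/
def yCoord (i : Fin n) (p : TangentBundle (𝓡 n) M) : ℝ := comp φ p.proj p.snd i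

/-- The covector `dx^i` on the tangent bundle, for the coordinates `(x, y)` induced by `φ`. -/
def dx (i : Fin n) (p : TangentBundle (𝓡 n) M) : TangentSpace (𝓡 n).tangent p →L[ℝ] ℝ :=
  mfderiv (𝓡 n).tangent 𝓘(ℝ, ℝ) (fun q : TangentBundle (𝓡 n) M ↦ φ q.proj i) p

/-- The covector `dy^i` on the tangent bundle, for the coordinates `(x, y)` induced by `φ`. -/
def dy (i : Fin n) (p : TangentBundle (𝓡 n) M) : TangentSpace (𝓡 n).tangent p →L[ℝ] ℝ :=
  mfderiv (𝓡 n).tangent 𝓘(ℝ, ℝ) (yCoord φ i) p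

/-- The covector `δy^i = dy^i + Γ^i_{hk} y^k dx^h`. -/
def deltay (i : Fin n) (p : TangentBundle (𝓡 n) M) : TangentSpace (𝓡 n).tangent p →L[ℝ] ℝ :=
  dy φ i p + ∑ h, ∑ k, (Gam g φ i h k (φ p.proj) * yCoord φ k p) • dx φ h p

/-- `½ ω_{ij} dx^i ∧ dx^j + g_{ij} dx^i ∧ δy^j` at the point `p`, in the chart `φ`. -/
def omegaTwoInChart (p : TangentBundle (𝓡 n) M) :
    (TangentSpace (𝓡 n).tangent p) [⋀^Fin 2]→L[ℝ] ℝ :=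
  (1 / 2 : ℝ) • (∑ i, ∑ j, omegaLow g X φ i j (φ p.proj) • wedge (dx φ i p) (dx φ j p)) +
    ∑ i, ∑ j, gLow g φ i j (φ p.proj) • wedge (dx φ i p) (deltay g φ j p)

/-- `- g_{ij} X^i dx^j + g_{ij} y^i dx^j` at the point `p`, in the chart `φ`. -/
def etaTwoInChart (p : TangentBundle (𝓡 n) M) :
    (TangentSpace (𝓡 n).tangent p) [⋀^Fin 1]→L[ℝ] ℝ :=
  oneForm (-(∑ i, ∑ j, (gLow g φ i j (φ p.proj) * XUp X φ i (φ p.proj)) • dx φ j p) +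
    ∑ i, ∑ j, (gLow g φ i j (φ p.proj) * yCoord φ i p) • dx φ j p)

/-- The 2-form `Ω₂` on the tangent bundle, computed at `p = (x, y)` in the preferred chart at `x`. -/
def omegaTwo : DiffForm (𝓡 n).tangent (TangentBundle (𝓡 n) M) 2 := fun p ↦
  omegaTwoInChart g X (chartAt (Vec n) p.proj) p

/-- The 1-form `η₂` on the tangent bundle, computed at `p = (x, y)` in the preferred chart at `x`. -/
def etaTwo : DiffForm (𝓡 n).tangent (TangentBundle (𝓡 n) M) 1 := fun p ↦
  etaTwoInChart g X (chartAt (Vec n) p.proj) p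

end Coordinates

end GeomDyn

end

/-! The proof rests on one formula. With a_j = g_{ij}(y^i - X^i) one has η₂ = ∑ a_j dx^j, which is
the intrinsic 1-form w ↦ g(y - X, dπ w); so η₂ does not depend on the chart (`etaTwoInChart_apply`).
In every chart the local expression of Ω₂ equals -∑ da_j ∧ dx^j (`omegaTwoInChart_eq_neg_sumWedge`),
that is -dη₂ (`IsLocalSum.extDerivForm`). Chart independence, smoothness and closedness of Ω₂ all
follow from this, and no transformation law for Γ or F is needed.

The formula comes from the identity Γ_{j,ik} - Γ_{i,jk} = ∂_i g_{jk} - ∂_j g_{ik} for Christoffel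
symbols of the first kind (`GamLow_sub`), used twice. It gives ω_{ij} = ∇_i X_j - ∇_j X_i = ∂_i X_j
- ∂_j X_i (`omegaLow_eq`), so ω is the differential of the covector field dual to X. It also matches
the Γ terms of g_{ij} dx^i ∧ δy^j with the derivatives of g that occur in da_j.

In the coframe (dx, δy) the matrix of Ω₂ has blocks ω, g, -g, 0, hence Ω₂ is nondegenerate. In the
same coframe dH = g_{ij} y^i δy^j - ∂_k f dx^k (`covector_hamiltonian`), so the vector with dx = y
and δy = grad f + F y is a solution of Ω₂(·, w) = dH(w), and the only one. Its components therefore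
have the same form in every chart (`dx_dy_hamField`). The half dx = y says that integral curves are
velocity lifts; the other half is the second-order system. -/

noncomputable section

namespace GeomDyn

/-! ### Exterior derivatives of 1-forms that are locally sums of a_j dx^j. -/

section Forms

variable {F : Type*} [NormedAddCommGroup F] [NormedSpace ℝ F] {H : Type*} [TopologicalSpace H]
  {J : ModelWithCorners ℝ F H} {N : Type*} [TopologicalSpace N] [ChartedSpace H N]

/-- The differential of a real function, as a covector. -/
abbrev covector (J : ModelWithCorners ℝ F H) (u : N → ℝ) (p : N) : TangentSpace J p →L[ℝ] ℝ :=
  mfderiv J 𝓘(ℝ, ℝ) u p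

@[simp] lemma wedge_apply {T : Type*} [AddCommGroup T] [Module ℝ T] [TopologicalSpace T]
    (a b : T →L[ℝ] ℝ) (v : Fin 2 → T) : wedge a b v = a (v 0) * b (v 1) - a (v 1) * b (v 0) := rfl

@[simp] lemma oneForm_apply {T : Type*} [AddCommGroup T] [Module ℝ T] [TopologicalSpace T]
    (a : T →L[ℝ] ℝ) (v : Fin 1 → T) : oneForm a v = a (v 0) := rfl

lemma two_le_infty : minSmoothness ℝ 2 ≤ ∞ := by
  rw [minSmoothness_of_isRCLikeNormedField]
  exact WithTop.coe_le_coe.2 (le_top : (2 : ℕ∞) ≤ ⊤)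

/-- The exterior derivative of `∑ a_j dx^j` on a vector space. -/
lemma extDeriv_sum_smul_fderiv {ι : Type*} [Fintype ι] {a x : ι → F → ℝ} {z : F}
    {β : F → F [⋀^Fin 1]→L[ℝ] ℝ}
    (hβ : ∀ᶠ w in nhds z, β w = oneForm (∑ j, a j w • fderiv ℝ (x j) w))
    (ha : ∀ j, ContDiffAt ℝ ∞ (a j) z) (hx : ∀ j, ContDiffAt ℝ ∞ (x j) z) :
    ContDiffAt ℝ ∞ β z ∧
      ∀ v : Fin 2 → F, extDeriv β z v =
        ∑ j, wedge (fderiv ℝ (a j) z) (fderiv ℝ (x j) z) v := by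
  have hfx : ∀ j, ContDiffAt ℝ ∞ (fderiv ℝ (x j)) z := fun j ↦
    (hx j).fderiv_right (m := ∞) le_rfl
  have hs : ContDiffAt ℝ ∞ (fun w ↦ ∑ j, a j w • fderiv ℝ (x j) w) z :=
    ContDiffAt.sum fun j _ ↦ (ha j).smul (hfx j)
  have hc : ContDiffAt ℝ ∞ β z := by
    refine ContDiffAt.congr_of_eventuallyEq ?_ hβ
    exact (ContinuousAlternatingMap.ofSubsingletonLIE (𝕜 := ℝ) (E := F) (F := ℝ)
      (0 : Fin 1)).contDiff.contDiffAt.comp z hs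
  refine ⟨hc, fun v ↦ ?_⟩
  have hd : ∀ u : F, fderiv ℝ (fun w ↦ β w ![u]) z =
      ∑ j, (a j z • (fderiv ℝ (fderiv ℝ (x j)) z).flip u +
        fderiv ℝ (x j) z u • fderiv ℝ (a j) z) := by
    intro u
    have he : (fun w ↦ β w ![u]) =ᶠ[nhds z] fun w ↦ ∑ j, a j w * fderiv ℝ (x j) w u := by
      filter_upwards [hβ] with w hw
      rw [hw]
      simp
    rw [he.fderiv_eq]
    refine HasFDerivAt.fderiv ?_
    refine HasFDerivAt.fun_sum fun j _ ↦ ?_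
    have h1 := ((ha j).differentiableAt (by simp)).hasFDerivAt
    have h2 := ((hfx j).differentiableAt (by simp)).hasFDerivAt
    have h3 : HasFDerivAt (fun w ↦ fderiv ℝ (x j) w u)
      ((fderiv ℝ (fderiv ℝ (x j)) z).flip u) z := by
      have := h2.clm_apply (hasFDerivAt_const u z)
      rwa [ContinuousLinearMap.comp_zero, zero_add] at this
    exact h1.mul h3
  rw [extDeriv_apply (hc.differentiableAt (by simp))]
  have e0 : (Fin.removeNth 0 v : Fin 1 → F) = ![v 1] := by
    ext i; fin_cases i; rfl
  have e1 : (Fin.removeNth 1 v : Fin 1 → F) = ![v 0] := by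
    ext i; fin_cases i; rfl
  refine (Fin.sum_univ_two _).trans ?_
  simp only [e0, e1, hd]
  -- The two terms a_j D²x_j cancel because second derivatives are symmetric; only da_j ∧ dx_j
  -- survives.
  have hsym : ∀ j, fderiv ℝ (fderiv ℝ (x j)) z (v 0) (v 1) =
      fderiv ℝ (fderiv ℝ (x j)) z (v 1) (v 0) := fun j ↦
    ((hx j).isSymmSndFDerivAt two_le_infty).eq (v 0) (v 1)
  simp only [Fin.val_zero, Fin.val_one, pow_zero, pow_one, one_smul, neg_smul,
    sum_apply, add_apply, smul_apply,
    ContinuousLinearMap.flip_apply, smul_eq_mul, wedge_apply, ← sub_eq_add_neg,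
    ← Finset.sum_sub_distrib]
  refine Finset.sum_congr rfl fun j _ ↦ ?_
  rw [hsym j]; ring

lemma formInChart_apply {k : ℕ} (α : DiffForm J N k) (q : N) (z : F) (v : Fin k → F) :
    formInChart J α q z v = α ((extChartAt J q).symm z)
      fun i ↦ mfderiv 𝓘(ℝ, F) J (extChartAt J q).symm z (v i) := rfl

lemma extDerivForm_apply {k : ℕ} (α : DiffForm J N k) (p : N)
    (v : Fin (k + 1) → TangentSpace J p) :
    extDerivForm J α p v = extDeriv (formInChart J α p) (extChartAt J p p)
      fun i ↦ mfderiv J 𝓘(ℝ, F) (extChartAt J p) p (v i) := rfl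

/-- All tangent spaces are definitionally the model space, so vectors at p and p' can be compared
there without a transport along p = p'. -/
lemma covector_congr (u : N → ℝ) {p p' : N} (h : p = p') {v v' : F} (hv : v = v') :
    covector J u p v = covector J u p' v' := by subst h hv; rfl

/-- A 1-form that is locally `∑ a_j dx^j` with smooth functions `a_j` and `x^j` on `U`. -/
structure IsLocalSum {ι : Type*} [Fintype ι] (α : DiffForm J N 1) (a x : ι → N → ℝ) (U : Set N) :
    Prop where
  isOpen : IsOpen U
  left (j : ι) : ∀ p ∈ U, ContMDiffAt J 𝓘(ℝ, ℝ) ∞ (a j) p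
  right (j : ι) : ∀ p ∈ U, ContMDiffAt J 𝓘(ℝ, ℝ) ∞ (x j) p
  eq : ∀ p ∈ U, α p = oneForm (∑ j, a j p • covector J (x j) p)

/-- The expression `∑ da_j ∧ dx^j`. -/
def sumWedge {ι : Type*} [Fintype ι] (a x : ι → N → ℝ) (p : N) :
    TangentSpace J p [⋀^Fin 2]→L[ℝ] ℝ :=
  ∑ j, wedge (covector J (a j) p) (covector J (x j) p)

lemma sumWedge_apply {ι : Type*} [Fintype ι] (a x : ι → N → ℝ) (p : N)
    (v : Fin 2 → TangentSpace J p) :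
    sumWedge (J := J) a x p v = ∑ j, (covector J (a j) p (v 0) * covector J (x j) p (v 1) -
      covector J (a j) p (v 1) * covector J (x j) p (v 0)) := by
  simp [sumWedge]

variable [J.Boundaryless] [IsManifold J ∞ N]

lemma contMDiffAt_extChartAt_symm (q : N) {z : F} (hz : z ∈ (extChartAt J q).target) :
    ContMDiffAt 𝓘(ℝ, F) J ∞ (extChartAt J q).symm z :=
  (contMDiffOn_extChartAt_symm q).contMDiffAt ((isOpen_extChartAt_target q).mem_nhds hz)

lemma contDiffAt_comp_extChartAt_symm {u : N → ℝ} (q : N) {z : F}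
    (hz : z ∈ (extChartAt J q).target)
    (hu : ContMDiffAt J 𝓘(ℝ, ℝ) ∞ u ((extChartAt J q).symm z)) :
    ContDiffAt ℝ ∞ (fun w ↦ u ((extChartAt J q).symm w)) z :=
  (hu.comp z (contMDiffAt_extChartAt_symm q hz)).contDiffAt

lemma fderiv_comp_extChartAt_symm {u : N → ℝ} (q : N) {z : F}
    (hz : z ∈ (extChartAt J q).target)
    (hu : ContMDiffAt J 𝓘(ℝ, ℝ) ∞ u ((extChartAt J q).symm z)) (w : F) :
    fderiv ℝ (fun w ↦ u ((extChartAt J q).symm w)) z w =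
      covector J u ((extChartAt J q).symm z) (mfderiv 𝓘(ℝ, F) J (extChartAt J q).symm z w) := by
  have h := mfderiv_comp z (hu.mdifferentiableAt (by simp))
    ((contMDiffAt_extChartAt_symm q hz).mdifferentiableAt (by simp))
  rw [mfderiv_eq_fderiv] at h
  exact DFunLike.congr_fun h w

/-- By the chain rule, pulling back by an inverse chart keeps the shape ∑ a_j dx^j, so the
computation on the model space applies. The chart is centred at an arbitrary q, not at the point
considered; smoothness on a whole chart target requires this. -/
lemma IsLocalSum.formInChart {ι : Type*} [Fintype ι] {α : DiffForm J N 1} {a x : ι → N → ℝ}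
    {U : Set N} (h : IsLocalSum α a x U) (q : N) {z : F} (hz : z ∈ (extChartAt J q).target)
    (hU : (extChartAt J q).symm z ∈ U) :
    ContDiffAt ℝ ∞ (formInChart J α q) z ∧ ∀ v : Fin 2 → F,
      extDeriv (formInChart J α q) z v =
        sumWedge a x ((extChartAt J q).symm z)
          fun i ↦ mfderiv 𝓘(ℝ, F) J (extChartAt J q).symm z (v i) := by
  have hev : ∀ᶠ w in nhds z, GeomDyn.formInChart J α q w =
      oneForm (∑ j, a j ((extChartAt J q).symm w) •
        fderiv ℝ (fun w ↦ x j ((extChartAt J q).symm w)) w) := by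
    filter_upwards [(isOpen_extChartAt_target q).mem_nhds hz,
      (contMDiffAt_extChartAt_symm q hz).continuousAt.preimage_mem_nhds
        (h.isOpen.mem_nhds hU)] with w hw hwU
    ext v
    rw [formInChart_apply, h.eq _ hwU, oneForm_apply, oneForm_apply, sum_apply, sum_apply]
    refine Finset.sum_congr rfl fun j _ ↦ ?_
    rw [smul_apply, smul_apply, fderiv_comp_extChartAt_symm q hw (h.right j _ hwU)]
  have := extDeriv_sum_smul_fderiv hev
    (fun j ↦ contDiffAt_comp_extChartAt_symm q hz (h.left j _ hU))
    (fun j ↦ contDiffAt_comp_extChartAt_symm q hz (h.right j _ hU))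
  refine ⟨this.1, fun v ↦ ?_⟩
  rw [this.2, sumWedge_apply]
  refine Finset.sum_congr rfl fun j _ ↦ ?_
  rw [wedge_apply]
  simp only [fderiv_comp_extChartAt_symm q hz (h.left j _ hU),
    fderiv_comp_extChartAt_symm q hz (h.right j _ hU)]

/-- Without boundary the range of the model is everything, so the derivative within the range is the
ordinary one. -/
lemma mfderiv_extChartAt_symm_apply (p : N) (v : TangentSpace J p) :
    (mfderiv 𝓘(ℝ, F) J (extChartAt J p).symm (extChartAt J p p)
      (mfderiv J 𝓘(ℝ, F) (extChartAt J p) p v) : F) = v := by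
  have h := mfderivWithin_extChartAt_symm_comp_mfderiv_extChartAt' (I := J)
    (mem_extChartAt_source (I := J) p)
  rw [J.range_eq_univ, mfderivWithin_univ] at h
  exact DFunLike.congr_fun h v

/-- The sum on the right mentions no chart of N: this is where the choice of the chart at p in the
definition of d becomes harmless. -/
lemma IsLocalSum.extDerivForm {ι : Type*} [Fintype ι] {α : DiffForm J N 1} {a x : ι → N → ℝ}
    {U : Set N} (h : IsLocalSum α a x U) {p : N} (hp : p ∈ U) :
    extDerivForm J α p = sumWedge a x p := by
  have h1 := (h.formInChart p (mem_extChartAt_target (I := J) p) (by simpa using hp)).2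
  ext v
  rw [extDerivForm_apply]
  refine (h1 _).trans ?_
  rw [sumWedge_apply, sumWedge_apply]
  refine Finset.sum_congr rfl fun j _ ↦ ?_
  have e (u : N → ℝ) (i : Fin 2) := covector_congr (J := J) u (extChartAt_to_inv (I := J) p)
    (mfderiv_extChartAt_symm_apply p (v i))
  exact congrArg₂ (· - ·) (congrArg₂ (· * ·) (e _ _) (e _ _)) (congrArg₂ (· * ·) (e _ _) (e _ _))

/-- A 2-form which is locally `-d` of a 1-form that is a local sum is smooth and closed. -/
lemma IsSmoothForm.neg_extDerivForm {ι : Type*} [Fintype ι] {α : DiffForm J N 1}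
    {Ω : DiffForm J N 2} {U : N → Set N} {a x : N → ι → N → ℝ} (hU : ∀ p, p ∈ U p)
    (h : ∀ p, IsLocalSum α (a p) (x p) (U p)) (hΩ : ∀ p, Ω p = -extDerivForm J α p) :
    IsSmoothForm J α ∧ IsSmoothForm J Ω ∧ ∀ p, extDerivForm J Ω p = 0 := by
  have h1 (q : N) (z : F) (hz : z ∈ (extChartAt J q).target) :=
    (h ((extChartAt J q).symm z)).formInChart q hz (hU _)
  have h2 (q : N) (z : F) (hz : z ∈ (extChartAt J q).target) :
      formInChart J Ω q z = -extDeriv (formInChart J α q) z := by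
    ext v
    have h3 := (h ((extChartAt J q).symm z)).extDerivForm (hU _)
    rw [formInChart_apply, hΩ, h3]
    exact (congrArg Neg.neg ((h1 q z hz).2 v)).symm
  -- Equality of germs, not only of values, since the form is about to be differentiated.
  have h4 (q : N) (z : F) (hz : z ∈ (extChartAt J q).target) :
      formInChart J Ω q =ᶠ[nhds z] -extDeriv (formInChart J α q) := by
    filter_upwards [(isOpen_extChartAt_target q).mem_nhds hz] with w hw using h2 q w hw
  refine ⟨fun q z hz ↦ (h1 q z hz).1.contDiffWithinAt, fun q z hz ↦ ?_, fun p ↦ ?_⟩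
  · refine (ContDiffAt.congr_of_eventuallyEq ?_ (h4 q z hz)).contDiffWithinAt
    refine ContDiffAt.neg ?_
    -- The exterior derivative is a continuous linear map applied to the Fréchet derivative.
    exact (ContinuousAlternatingMap.alternatizeUncurryFinCLM ℝ F ℝ).contDiff.contDiffAt.comp z
      ((h1 q z hz).1.fderiv_right (m := ∞) le_rfl)
  · have hz := mem_extChartAt_target (I := J) p
    have h5 : extDeriv (formInChart J Ω p) (extChartAt J p p) = 0 := by
      rw [(h4 p _ hz).extDeriv_eq]
      have h6 : -extDeriv (formInChart J α p) = (-1 : ℝ) • extDeriv (formInChart J α p) := by simp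
      rw [h6, extDeriv_smul, extDeriv_extDeriv_apply (h1 p _ hz).1 two_le_infty,
        smul_zero]
    ext v
    rw [extDerivForm_apply, h5]
    rfl

end Forms

/-! ### The charts of the tangent bundle induced by charts of the base. -/

section TangentChart

/-- Charts and their inverses are smooth only on open sets. There the derivative within the set is
the full derivative, so the statement for `tangentMapWithin` carries over. -/
lemma ContMDiffOn.contMDiffAt_tangentMap {E : Type*} [NormedAddCommGroup E] [NormedSpace ℝ E]
    {H : Type*} [TopologicalSpace H] {I : ModelWithCorners ℝ E H} {M : Type*} [TopologicalSpace M]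
    [ChartedSpace H M] {E' : Type*} [NormedAddCommGroup E'] [NormedSpace ℝ E'] {H' : Type*}
    [TopologicalSpace H'] {I' : ModelWithCorners ℝ E' H'} {M' : Type*} [TopologicalSpace M']
    [ChartedSpace H' M'] [IsManifold I 1 M] [IsManifold I' 1 M'] {f : M → M'} {s : Set M}
    {k m : ℕ∞ω} (hf : ContMDiffOn I I' k f s) (hs : IsOpen s) (hkm : m + 1 ≤ k)
    {p : TangentBundle I M} (hp : p.proj ∈ s) :
    ContMDiffAt I.tangent I'.tangent m (tangentMap I I' f) p := by
  have h1 := hf.contMDiffOn_tangentMapWithin hkm hs.uniqueMDiffOn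
  have ho : IsOpen (TotalSpace.proj ⁻¹' s : Set (TangentBundle I M)) :=
    hs.preimage (FiberBundle.continuous_proj E (TangentSpace I))
  refine (h1.contMDiffAt (ho.mem_nhds hp)).congr_of_eventuallyEq ?_
  filter_upwards [ho.mem_nhds hp] with q hq
  rw [tangentMapWithin, tangentMap, mfderivWithin_of_isOpen hs hq]

/-- Allows a pair (coordinates, components) to be fed into a tangent map. -/
lemma contMDiff_mk_modelSpace {E : Type*} [NormedAddCommGroup E] [NormedSpace ℝ E] {k : ℕ∞ω} :
    ContMDiff 𝓘(ℝ, E × E) 𝓘(ℝ, E).tangent k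
      (fun w : E × E ↦ (⟨w.1, w.2⟩ : TangentBundle 𝓘(ℝ, E) E)) := by
  intro w
  refine (Bundle.contMDiffAt_totalSpace (F := E) (E := TangentSpace 𝓘(ℝ, E))).2
    ⟨contDiff_fst.contMDiff.contMDiffAt, ?_⟩
  have : ContMDiffAt 𝓘(ℝ, E × E) 𝓘(ℝ, E) k (fun w : E × E ↦ w.2) w :=
    contDiff_snd.contMDiff.contMDiffAt
  convert this using 2 with y
  simp

lemma tangentBundle_mk_congr {E : Type*} [NormedAddCommGroup E] [NormedSpace ℝ E] {H : Type*}
    [TopologicalSpace H] {I : ModelWithCorners ℝ E H} {N : Type*} [TopologicalSpace N]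
    [ChartedSpace H N] {x x' : N} (h : x = x') {v v' : E} (hv : v = v') :
    (⟨x, v⟩ : TangentBundle I N) = ⟨x', v'⟩ := by
  subst h hv; rfl

variable {n : ℕ} {M : Type*} [TopologicalSpace M] [ChartedSpace (Vec n) M] [IsManifold (𝓡 n) ∞ M]
  {φ : OpenPartialHomeomorph M (Vec n)}

omit [IsManifold (𝓡 n) ∞ M] in
lemma mdifferentiable_of_mem_maximalAtlas (hφ : φ ∈ IsManifold.maximalAtlas (𝓡 n) ∞ M) :
    φ.MDifferentiable (𝓡 n) (𝓡 n) :=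
  ⟨(contMDiffOn_of_mem_maximalAtlas hφ).mdifferentiableOn (by simp),
    (contMDiffOn_symm_of_mem_maximalAtlas hφ).mdifferentiableOn (by simp)⟩

omit [IsManifold (𝓡 n) ∞ M] in
lemma mfderiv_symm_comp (hφ : φ ∈ IsManifold.maximalAtlas (𝓡 n) ∞ M) {x : M} (hx : x ∈ φ.source)
    (v : TangentSpace (𝓡 n) x) :
    (mfderiv (𝓡 n) (𝓡 n) φ.symm (φ x) (comp φ x v) : Vec n) = v :=
  DFunLike.congr_fun ((mdifferentiable_of_mem_maximalAtlas hφ).symm_comp_deriv hx) v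

omit [IsManifold (𝓡 n) ∞ M] in
lemma comp_mfderiv_symm (hφ : φ ∈ IsManifold.maximalAtlas (𝓡 n) ∞ M) {z : Vec n}
    (hz : z ∈ φ.target) (v : Vec n) :
    comp φ (φ.symm z) (mfderiv (𝓡 n) (𝓡 n) φ.symm z v) = v :=
  DFunLike.congr_fun ((mdifferentiable_of_mem_maximalAtlas hφ).comp_symm_deriv hz) v

lemma contMDiffAt_comp (hφ : φ ∈ IsManifold.maximalAtlas (𝓡 n) ∞ M)
    {p : TangentBundle (𝓡 n) M} (hp : p.proj ∈ φ.source) :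
    ContMDiffAt (𝓡 n).tangent 𝓘(ℝ, Vec n) ∞
      (fun q : TangentBundle (𝓡 n) M ↦ comp φ q.proj q.snd) p :=
  (contMDiff_snd_tangentBundle_modelSpace (Vec n) (𝓡 n)).contMDiffAt.comp p
    (ContMDiffOn.contMDiffAt_tangentMap (contMDiffOn_of_mem_maximalAtlas hφ) φ.open_source
      (m := ∞) le_rfl hp)

lemma contMDiffAt_chart_proj (hφ : φ ∈ IsManifold.maximalAtlas (𝓡 n) ∞ M)
    {p : TangentBundle (𝓡 n) M} (hp : p.proj ∈ φ.source) :
    ContMDiffAt (𝓡 n).tangent (𝓡 n) ∞ (fun q : TangentBundle (𝓡 n) M ↦ φ q.proj) p :=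
  (contMDiffAt_of_mem_maximalAtlas hφ hp).comp p
    (contMDiff_proj (TangentSpace (𝓡 n))).contMDiffAt

lemma contMDiffAt_tangentChart (hφ : φ ∈ IsManifold.maximalAtlas (𝓡 n) ∞ M)
    {p : TangentBundle (𝓡 n) M} (hp : p.proj ∈ φ.source) :
    ContMDiffAt (𝓡 n).tangent 𝓘(ℝ, Vec n × Vec n) ∞
      (fun q : TangentBundle (𝓡 n) M ↦ (φ q.proj, comp φ q.proj q.snd)) p :=
  (contMDiffAt_chart_proj hφ hp).prodMk_space (contMDiffAt_comp hφ hp)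

lemma contMDiffAt_tangentChart_symm (hφ : φ ∈ IsManifold.maximalAtlas (𝓡 n) ∞ M)
    {w : Vec n × Vec n} (hw : w.1 ∈ φ.target) :
    ContMDiffAt 𝓘(ℝ, Vec n × Vec n) (𝓡 n).tangent ∞
      (fun w : Vec n × Vec n ↦
        (⟨φ.symm w.1, mfderiv (𝓡 n) (𝓡 n) φ.symm w.1 w.2⟩ : TangentBundle (𝓡 n) M)) w := by
  have h := ContMDiffOn.contMDiffAt_tangentMap (contMDiffOn_symm_of_mem_maximalAtlas hφ)
    φ.open_target (m := ∞) le_rfl (p := (⟨w.1, w.2⟩ : TangentBundle (𝓡 n) (Vec n))) hw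
  exact ContMDiffAt.comp w h contMDiff_mk_modelSpace.contMDiffAt

/-- The chart `(x, y)` of the tangent bundle induced by a chart of the base. -/
def tangentChart (hφ : φ ∈ IsManifold.maximalAtlas (𝓡 n) ∞ M) :
    OpenPartialHomeomorph (TangentBundle (𝓡 n) M) (Vec n × Vec n) where
  toFun p := (φ p.proj, comp φ p.proj p.snd)
  invFun w := ⟨φ.symm w.1, mfderiv (𝓡 n) (𝓡 n) φ.symm w.1 w.2⟩
  source := TotalSpace.proj ⁻¹' φ.source
  target := Prod.fst ⁻¹' φ.target
  map_source' _ hp := φ.map_source hp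
  map_target' _ hw := φ.map_target hw
  left_inv' := by
    rintro ⟨x, v⟩ hx
    exact tangentBundle_mk_congr (φ.left_inv hx) (mfderiv_symm_comp hφ hx v)
  right_inv' := by
    rintro ⟨z, v⟩ hz
    exact Prod.ext (φ.right_inv hz) (comp_mfderiv_symm hφ hz v)
  open_source := φ.open_source.preimage (FiberBundle.continuous_proj (Vec n) (TangentSpace (𝓡 n)))
  open_target := φ.open_target.preimage continuous_fst
  continuousOn_toFun _ hp := (contMDiffAt_tangentChart hφ hp).continuousAt.continuousWithinAt
  continuousOn_invFun _ hw := (contMDiffAt_tangentChart_symm hφ hw).continuousAt.continuousWithinAt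

lemma mdifferentiable_tangentChart (hφ : φ ∈ IsManifold.maximalAtlas (𝓡 n) ∞ M) :
    (tangentChart hφ).MDifferentiable (𝓡 n).tangent 𝓘(ℝ, Vec n × Vec n) :=
  ⟨fun _ hp ↦ ((contMDiffAt_tangentChart hφ hp).mdifferentiableAt
      (by simp)).mdifferentiableWithinAt,
    fun _ hw ↦ ((contMDiffAt_tangentChart_symm hφ hw).mdifferentiableAt
      (by simp)).mdifferentiableWithinAt⟩

lemma contMDiffAt_coord (hφ : φ ∈ IsManifold.maximalAtlas (𝓡 n) ∞ M)
    {p : TangentBundle (𝓡 n) M} (hp : p.proj ∈ φ.source) (i : Fin n) :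
    ContMDiffAt (𝓡 n).tangent 𝓘(ℝ, ℝ) ∞ (fun q : TangentBundle (𝓡 n) M ↦ φ q.proj i) p :=
  (EuclideanSpace.proj (𝕜 := ℝ) i).contDiff.contDiffAt.comp_contMDiffAt (contMDiffAt_chart_proj hφ hp)

lemma contMDiffAt_yCoord (hφ : φ ∈ IsManifold.maximalAtlas (𝓡 n) ∞ M)
    {p : TangentBundle (𝓡 n) M} (hp : p.proj ∈ φ.source) (i : Fin n) :
    ContMDiffAt (𝓡 n).tangent 𝓘(ℝ, ℝ) ∞ (yCoord φ i) p :=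
  (EuclideanSpace.proj (𝕜 := ℝ) i).contDiff.contDiffAt.comp_contMDiffAt (contMDiffAt_comp hφ hp)

lemma mfderiv_tangentChart_apply (hφ : φ ∈ IsManifold.maximalAtlas (𝓡 n) ∞ M)
    {p : TangentBundle (𝓡 n) M} (hp : p.proj ∈ φ.source)
    (v : TangentSpace (𝓡 n).tangent p) :
    (mfderiv (𝓡 n).tangent 𝓘(ℝ, Vec n × Vec n) (tangentChart hφ) p v : Vec n × Vec n) =
      (WithLp.toLp 2 fun i ↦ dx φ i p v, WithLp.toLp 2 fun i ↦ dy φ i p v) := by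
  have h := (contMDiffAt_tangentChart hφ hp).mdifferentiableAt (by simp)
  -- The chain rule for a linear form L, to be used with the coordinate projections of both factors.
  have key (L : Vec n × Vec n →L[ℝ] ℝ) :
      covector (𝓡 n).tangent (fun q ↦ L (tangentChart hφ q)) p v =
        L (mfderiv (𝓡 n).tangent 𝓘(ℝ, Vec n × Vec n) (tangentChart hφ) p v) := by
    have h2 := mfderiv_comp p (L.hasFDerivAt.hasMFDerivAt.mdifferentiableAt) h
    exact (DFunLike.congr_fun h2 v).trans
      (DFunLike.congr_fun (L.hasFDerivAt.hasMFDerivAt.mfderiv (x := tangentChart hφ p)) _)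
  refine Prod.ext ?_ ?_
  · ext i
    exact (key (EuclideanSpace.proj i ∘L .fst ℝ _ _)).symm
  · ext i
    exact (key (EuclideanSpace.proj i ∘L .snd ℝ _ _)).symm

/-- `(dx, dy)` is an isomorphism. -/
lemma dx_dy_ext (hφ : φ ∈ IsManifold.maximalAtlas (𝓡 n) ∞ M)
    {p : TangentBundle (𝓡 n) M} (hp : p.proj ∈ φ.source)
    {v w : TangentSpace (𝓡 n).tangent p} (h1 : ∀ i, dx φ i p v = dx φ i p w)
    (h2 : ∀ i, dy φ i p v = dy φ i p w) : v = w := by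
  refine ((mdifferentiable_tangentChart hφ).mfderiv_bijective hp).1 ?_
  refine (mfderiv_tangentChart_apply hφ hp v).trans
    (Eq.trans ?_ (mfderiv_tangentChart_apply hφ hp w).symm)
  simp only [h1, h2]
  rfl

lemma exists_dx_dy (hφ : φ ∈ IsManifold.maximalAtlas (𝓡 n) ∞ M)
    {p : TangentBundle (𝓡 n) M} (hp : p.proj ∈ φ.source) (a b : Fin n → ℝ) :
    ∃ v : TangentSpace (𝓡 n).tangent p, (∀ i, dx φ i p v = a i) ∧ ∀ i, dy φ i p v = b i := by
  obtain ⟨v, hv⟩ := ((mdifferentiable_tangentChart hφ).mfderiv_bijective hp).2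
    (WithLp.toLp 2 a, WithLp.toLp 2 b)
  have h := (mfderiv_tangentChart_apply hφ hp v).symm.trans hv
  exact ⟨v, fun i ↦ congrArg (fun w : Vec n × Vec n ↦ w.1 i) h,
    fun i ↦ congrArg (fun w : Vec n × Vec n ↦ w.2 i) h⟩

end TangentChart

/-! ### Components of the metric, and smoothness of all component functions. -/

section Components

variable {n : ℕ} {M : Type*} [TopologicalSpace M] [ChartedSpace (Vec n) M] [IsManifold (𝓡 n) ∞ M]
  {g : SemiRiemannMetric n M} {X : (x : M) → TangentSpace (𝓡 n) x}
  {φ : OpenPartialHomeomorph M (Vec n)}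

lemma sum_smul_stdVec (c : Vec n) : ∑ i, c i • stdVec i = c := by
  ext j
  simp [Pi.single_apply]

omit [IsManifold (𝓡 n) ∞ M] in
lemma mfderiv_symm_eq_sum (z c : Vec n) :
    (mfderiv (𝓡 n) (𝓡 n) φ.symm z c : TangentSpace (𝓡 n) (φ.symm z)) =
      ∑ i, c i • coordField φ i z := by
  have h := congrArg (mfderiv (𝓡 n) (𝓡 n) φ.symm z) (sum_smul_stdVec c).symm
  refine h.trans ?_
  refine (map_sum (mfderiv (𝓡 n) (𝓡 n) φ.symm z) _ _).trans ?_
  exact Finset.sum_congr rfl fun i _ ↦ map_smul (mfderiv (𝓡 n) (𝓡 n) φ.symm z) _ _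

lemma inner_mfderiv_symm (z c d : Vec n) :
    g.inner (φ.symm z) (mfderiv (𝓡 n) (𝓡 n) φ.symm z c) (mfderiv (𝓡 n) (𝓡 n) φ.symm z d) =
      ∑ i, ∑ j, gLow g φ i j z * c i * d j := by
  rw [mfderiv_symm_eq_sum, mfderiv_symm_eq_sum]
  simp only [map_sum, map_smul, sum_apply, smul_apply, smul_eq_mul, gLow]
  simp_rw [Finset.mul_sum]
  rw [Finset.sum_comm]
  refine Finset.sum_congr rfl fun i _ ↦ ?_
  exact Finset.sum_congr rfl fun j _ ↦ by ring

lemma inner_eq_sum (hφ : φ ∈ IsManifold.maximalAtlas (𝓡 n) ∞ M) {x : M} (hx : x ∈ φ.source)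
    (v w : TangentSpace (𝓡 n) x) :
    g.inner x v w = ∑ i, ∑ j, gLow g φ i j (φ x) * comp φ x v i * comp φ x w j := by
  -- The components `gLow` live over φ.symm (φ x); writing x itself as φ.symm z avoids a transport
  -- between tangent spaces.
  obtain ⟨z, hz, rfl⟩ : ∃ z ∈ φ.target, φ.symm z = x := ⟨φ x, φ.map_source hx, φ.left_inv hx⟩
  have key (u : TangentSpace (𝓡 n) (φ.symm z)) :
      (mfderiv (𝓡 n) (𝓡 n) φ.symm z (comp φ (φ.symm z) u) : TangentSpace (𝓡 n) (φ.symm z)) = u := by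
    have := mfderiv_symm_comp hφ hx u
    rwa [φ.right_inv hz] at this
  rw [φ.right_inv hz, ← inner_mfderiv_symm, key, key]

lemma gLow_symm (i j : Fin n) (z : Vec n) : gLow g φ i j z = gLow g φ j i z :=
  g.symm _ _ _

/-- The tangent vector with components c is g-orthogonal to every vector, and g is nondegenerate.
Besides the invertibility of the matrix g_{ij}, it yields the nondegeneracy of Ω₂. -/
lemma eq_zero_of_sum_gLow (hφ : φ ∈ IsManifold.maximalAtlas (𝓡 n) ∞ M) {z : Vec n}
    (hz : z ∈ φ.target) {c : Fin n → ℝ} (hc : ∀ i, ∑ j, gLow g φ i j z * c j = 0) : c = 0 := by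
  have h : (mfderiv (𝓡 n) (𝓡 n) φ.symm z (WithLp.toLp 2 c) : TangentSpace (𝓡 n) (φ.symm z)) = 0 := by
    refine g.nondegenerate _ _ fun w ↦ ?_
    rw [g.symm, inner_eq_sum hφ (φ.map_target hz), φ.right_inv hz]
    refine Finset.sum_eq_zero fun i _ ↦ ?_
    have e := comp_mfderiv_symm hφ hz (WithLp.toLp 2 c)
    calc _ = comp φ (φ.symm z) w i * ∑ j, gLow g φ i j z * c j := by
          rw [Finset.mul_sum]
          refine Finset.sum_congr rfl fun j _ ↦ ?_
          rw [congrArg (fun u : Vec n ↦ u j) e]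
          ring
      _ = 0 := by rw [hc, mul_zero]
  have e := comp_mfderiv_symm hφ hz (WithLp.toLp 2 c)
  have h0 : comp φ (φ.symm z) (0 : TangentSpace (𝓡 n) (φ.symm z)) = 0 :=
    map_zero (mfderiv (𝓡 n) (𝓡 n) φ (φ.symm z))
  rw [h, h0] at e
  funext i
  exact (congrArg (fun u : Vec n ↦ u i) e).symm

lemma det_gLow_ne_zero (hφ : φ ∈ IsManifold.maximalAtlas (𝓡 n) ∞ M) {z : Vec n}
    (hz : z ∈ φ.target) : (Matrix.of fun a b ↦ gLow g φ a b z).det ≠ 0 := by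
  intro h
  obtain ⟨c, hc, h0⟩ := Matrix.exists_mulVec_eq_zero_iff.2 h
  exact hc (eq_zero_of_sum_gLow hφ hz fun i ↦ congrFun h0 i)

lemma sum_gLow_mul_gUp (hφ : φ ∈ IsManifold.maximalAtlas (𝓡 n) ∞ M) {z : Vec n}
    (hz : z ∈ φ.target) (i j : Fin n) :
    ∑ l, gLow g φ i l z * gUp g φ l j z = if i = j then 1 else 0 := by
  have h := Matrix.mul_nonsing_inv (Matrix.of fun a b ↦ gLow g φ a b z)
    (det_gLow_ne_zero hφ hz).isUnit
  have h1 := congrFun (congrFun h i) j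
  rwa [Matrix.mul_apply, Matrix.one_apply] at h1

lemma sum_gLow_mul_sum_gUp (hφ : φ ∈ IsManifold.maximalAtlas (𝓡 n) ∞ M) {z : Vec n}
    (hz : z ∈ φ.target) (i : Fin n) (u : Fin n → ℝ) :
    ∑ l, gLow g φ i l z * ∑ j, gUp g φ l j z * u j = u i := by
  simp_rw [Finset.mul_sum]
  rw [Finset.sum_comm]
  simp_rw [← mul_assoc, ← Finset.sum_mul, sum_gLow_mul_gUp hφ hz]
  simp

/-! ### Smoothness -/

/-- Stated for vector fields along a map b, so that it covers coordinate fields, X, and the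
tautological field (x, y) ↦ y on the tangent bundle. -/
lemma contMDiffAt_inner {E : Type*} [NormedAddCommGroup E] [NormedSpace ℝ E] {H : Type*}
    [TopologicalSpace H] {I : ModelWithCorners ℝ E H} {N : Type*} [TopologicalSpace N]
    [ChartedSpace H N] {b : N → M} {v w : (m : N) → TangentSpace (𝓡 n) (b m)} {m : N}
    (hv : ContMDiffAt I (𝓡 n).tangent ∞ (fun m ↦ (⟨b m, v m⟩ : TangentBundle (𝓡 n) M)) m)
    (hw : ContMDiffAt I (𝓡 n).tangent ∞ (fun m ↦ (⟨b m, w m⟩ : TangentBundle (𝓡 n) M)) m) :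
    ContMDiffAt I 𝓘(ℝ, ℝ) ∞ (fun m ↦ g.inner (b m) (v m) (w m)) m := by
  have hb : ContMDiffAt I (𝓡 n) ∞ b m := (contMDiff_proj (TangentSpace (𝓡 n))).contMDiffAt.comp m hv
  have : ContMDiffAt I ((𝓡 n).prod 𝓘(ℝ, ℝ)) ∞
      (fun m ↦ TotalSpace.mk' ℝ (E := Bundle.Trivial M ℝ) (b m) (g.inner (b m) (v m) (w m))) m := by
    apply ContMDiffAt.clm_bundle_apply₂ (F₁ := Vec n) (F₂ := Vec n)
    · exact g.contMDiff.contMDiffAt.comp m hb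
    · exact hv
    · exact hw
  rw [contMDiffAt_totalSpace] at this
  exact this.2

lemma contMDiffAt_coordField (hφ : φ ∈ IsManifold.maximalAtlas (𝓡 n) ∞ M) {z : Vec n}
    (hz : z ∈ φ.target) (i : Fin n) :
    ContMDiffAt (𝓡 n) (𝓡 n).tangent ∞
      (fun z ↦ (⟨φ.symm z, coordField φ i z⟩ : TangentBundle (𝓡 n) M)) z := by
  have h : ContMDiffAt 𝓘(ℝ, Vec n) 𝓘(ℝ, Vec n × Vec n) ∞ (fun z : Vec n ↦ (z, stdVec i)) z :=
    (contDiff_id.prodMk contDiff_const).contMDiff.contMDiffAt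
  exact (contMDiffAt_tangentChart_symm hφ (w := (z, stdVec i)) hz).comp z h

lemma contDiffAt_gLow (hφ : φ ∈ IsManifold.maximalAtlas (𝓡 n) ∞ M) {z : Vec n}
    (hz : z ∈ φ.target) (i j : Fin n) : ContDiffAt ℝ ∞ (gLow g φ i j) z :=
  (contMDiffAt_inner (contMDiffAt_coordField hφ hz i)
    (contMDiffAt_coordField hφ hz j)).contDiffAt

lemma contDiffAt_det {E : Type*} [NormedAddCommGroup E] [NormedSpace ℝ E]
    {A : E → Matrix (Fin n) (Fin n) ℝ} {z : E} (h : ∀ i j, ContDiffAt ℝ ∞ (fun z ↦ A z i j) z) :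
    ContDiffAt ℝ ∞ (fun z ↦ (A z).det) z := by
  simp_rw [Matrix.det_apply]
  exact ContDiffAt.sum fun σ _ ↦ (contDiffAt_prod fun i _ ↦ h _ _).const_smul _

lemma contDiffAt_gUp (hφ : φ ∈ IsManifold.maximalAtlas (𝓡 n) ∞ M) {z : Vec n}
    (hz : z ∈ φ.target) (i j : Fin n) : ContDiffAt ℝ ∞ (gUp g φ i j) z := by
  -- Cramer's rule: an inverse entry is a quotient of determinants, hence smooth.
  have h : gUp g φ i j = fun z ↦ ((Matrix.of fun a b ↦ gLow g φ a b z).det)⁻¹ *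
      ((Matrix.of fun a b ↦ gLow g φ a b z).updateRow j (Pi.single i 1)).det := by
    funext z
    rw [gUp, Matrix.inv_def, Matrix.smul_apply, Matrix.adjugate_apply, Ring.inverse_eq_inv',
      smul_eq_mul]
  rw [h]
  refine ((contDiffAt_det fun a b ↦ contDiffAt_gLow hφ hz a b).inv
    (det_gLow_ne_zero hφ hz)).mul (contDiffAt_det fun a b ↦ ?_)
  by_cases hab : a = j
  · simp only [hab, Matrix.updateRow_self]
    exact contDiffAt_const
  · simp only [Matrix.updateRow_ne hab]
    exact contDiffAt_gLow hφ hz a b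

lemma contDiffAt_pd {u : Vec n → ℝ} {z : Vec n} (hu : ContDiffAt ℝ ∞ u z) (i : Fin n) :
    ContDiffAt ℝ ∞ (pd i u) z :=
  (hu.fderiv_right (m := ∞) le_rfl).clm_apply contDiffAt_const

lemma contDiffAt_Gam (hφ : φ ∈ IsManifold.maximalAtlas (𝓡 n) ∞ M) {z : Vec n}
    (hz : z ∈ φ.target) (i j k : Fin n) : ContDiffAt ℝ ∞ (Gam g φ i j k) z :=
  contDiffAt_const.mul (ContDiffAt.sum fun l _ ↦ (contDiffAt_gUp hφ hz i l).mul
    (((contDiffAt_pd (contDiffAt_gLow hφ hz l k) j).add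
      (contDiffAt_pd (contDiffAt_gLow hφ hz l j) k)).sub
      (contDiffAt_pd (contDiffAt_gLow hφ hz j k) l)))

lemma contMDiffAt_field_symm (hX : ContMDiff (𝓡 n) (𝓡 n).tangent ∞
      (fun x ↦ (⟨x, X x⟩ : TangentBundle (𝓡 n) M)))
    (hφ : φ ∈ IsManifold.maximalAtlas (𝓡 n) ∞ M) {z : Vec n} (hz : z ∈ φ.target) :
    ContMDiffAt (𝓡 n) (𝓡 n).tangent ∞
      (fun z ↦ (⟨φ.symm z, X (φ.symm z)⟩ : TangentBundle (𝓡 n) M)) z :=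
  hX.contMDiffAt.comp z (contMDiffAt_symm_of_mem_maximalAtlas hφ hz)

lemma contDiffAt_XUp (hX : ContMDiff (𝓡 n) (𝓡 n).tangent ∞
      (fun x ↦ (⟨x, X x⟩ : TangentBundle (𝓡 n) M)))
    (hφ : φ ∈ IsManifold.maximalAtlas (𝓡 n) ∞ M) {z : Vec n} (hz : z ∈ φ.target) (i : Fin n) :
    ContDiffAt ℝ ∞ (XUp X φ i) z :=
  (ContMDiffAt.comp (g := yCoord φ i) z
    (contMDiffAt_yCoord hφ (p := ⟨φ.symm z, X (φ.symm z)⟩) (φ.map_target hz) i)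
    (contMDiffAt_field_symm hX hφ hz)).contDiffAt

lemma contDiffAt_nablaX (hX : ContMDiff (𝓡 n) (𝓡 n).tangent ∞
      (fun x ↦ (⟨x, X x⟩ : TangentBundle (𝓡 n) M)))
    (hφ : φ ∈ IsManifold.maximalAtlas (𝓡 n) ∞ M) {z : Vec n} (hz : z ∈ φ.target) (j i : Fin n) :
    ContDiffAt ℝ ∞ (nablaX g X φ j i) z :=
  (contDiffAt_pd (contDiffAt_XUp hX hφ hz i) j).add
    (ContDiffAt.sum fun k _ ↦ (contDiffAt_Gam hφ hz i j k).mul (contDiffAt_XUp hX hφ hz k))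

lemma contDiffAt_Fmix (hX : ContMDiff (𝓡 n) (𝓡 n).tangent ∞
      (fun x ↦ (⟨x, X x⟩ : TangentBundle (𝓡 n) M)))
    (hφ : φ ∈ IsManifold.maximalAtlas (𝓡 n) ∞ M) {z : Vec n} (hz : z ∈ φ.target) (j i : Fin n) :
    ContDiffAt ℝ ∞ (Fmix g X φ j i) z :=
  (contDiffAt_nablaX hX hφ hz j i).sub (ContDiffAt.sum fun h _ ↦ ContDiffAt.sum fun k _ ↦
    ((contDiffAt_gUp hφ hz i h).mul (contDiffAt_gLow hφ hz k j)).mul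
      (contDiffAt_nablaX hX hφ hz h k))

lemma contMDiff_energy (hX : ContMDiff (𝓡 n) (𝓡 n).tangent ∞
      (fun x ↦ (⟨x, X x⟩ : TangentBundle (𝓡 n) M))) :
    ContMDiff (𝓡 n) 𝓘(ℝ, ℝ) ∞ (energy g X) := by
  intro x
  have h : ContMDiffAt (𝓡 n) 𝓘(ℝ, ℝ) ∞ (fun x ↦ g.inner x (X x) (X x)) x :=
    contMDiffAt_inner hX.contMDiffAt hX.contMDiffAt
  exact (contDiff_const.mul contDiff_id : ContDiff ℝ ∞ fun t : ℝ ↦ (1 / 2) * t).comp_contMDiffAt h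

lemma contDiffAt_energy_symm (hX : ContMDiff (𝓡 n) (𝓡 n).tangent ∞
      (fun x ↦ (⟨x, X x⟩ : TangentBundle (𝓡 n) M)))
    (hφ : φ ∈ IsManifold.maximalAtlas (𝓡 n) ∞ M) {z : Vec n} (hz : z ∈ φ.target) :
    ContDiffAt ℝ ∞ (fun w ↦ energy g X (φ.symm w)) z :=
  ((contMDiff_energy hX).contMDiffAt.comp z
    (contMDiffAt_symm_of_mem_maximalAtlas hφ hz)).contDiffAt

lemma contDiffAt_gradEnergy (hX : ContMDiff (𝓡 n) (𝓡 n).tangent ∞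
      (fun x ↦ (⟨x, X x⟩ : TangentBundle (𝓡 n) M)))
    (hφ : φ ∈ IsManifold.maximalAtlas (𝓡 n) ∞ M) {z : Vec n} (hz : z ∈ φ.target) (i : Fin n) :
    ContDiffAt ℝ ∞ (gradEnergy g X φ i) z :=
  ContDiffAt.sum fun j _ ↦ (contDiffAt_gUp hφ hz i j).mul
    (contDiffAt_pd (contDiffAt_energy_symm hX hφ hz) j)

lemma contMDiff_hamiltonian (hX : ContMDiff (𝓡 n) (𝓡 n).tangent ∞
      (fun x ↦ (⟨x, X x⟩ : TangentBundle (𝓡 n) M))) :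
    ContMDiff (𝓡 n).tangent 𝓘(ℝ, ℝ) ∞ (hamiltonian g X) := by
  intro p
  have h : ContMDiffAt (𝓡 n).tangent 𝓘(ℝ, ℝ) ∞
      (fun q : TangentBundle (𝓡 n) M ↦ g.inner q.proj q.snd q.snd) p :=
    contMDiffAt_inner contMDiffAt_id contMDiffAt_id
  have h2 : ContMDiffAt (𝓡 n).tangent 𝓘(ℝ, ℝ) ∞
      (fun q : TangentBundle (𝓡 n) M ↦ energy g X q.proj) p :=
    (contMDiff_energy hX).contMDiffAt.comp p (contMDiff_proj (TangentSpace (𝓡 n))).contMDiffAt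
  exact ((contDiff_const.mul contDiff_id :
    ContDiff ℝ ∞ fun t : ℝ ↦ (1 / 2) * t).comp_contMDiffAt h).sub h2

end Components

/-! ### Differentials on the tangent bundle, and the identity Ω₂ = -dη₂. -/

section Differentials

variable {n : ℕ} {M : Type*} [TopologicalSpace M] [ChartedSpace (Vec n) M] [IsManifold (𝓡 n) ∞ M]
  {g : SemiRiemannMetric n M} {X : (x : M) → TangentSpace (𝓡 n) x}
  {φ : OpenPartialHomeomorph M (Vec n)}

lemma dx_apply (hφ : φ ∈ IsManifold.maximalAtlas (𝓡 n) ∞ M) {p : TangentBundle (𝓡 n) M}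
    (hp : p.proj ∈ φ.source) (i : Fin n) (v : TangentSpace (𝓡 n).tangent p) :
    dx φ i p v = comp φ p.proj (mfderiv (𝓡 n).tangent (𝓡 n) TotalSpace.proj p v) i := by
  have h1 : MDifferentiableAt (𝓡 n).tangent (𝓡 n)
      (TotalSpace.proj : TangentBundle (𝓡 n) M → M) p :=
    (contMDiff_proj (n := ∞) (TangentSpace (𝓡 n))).contMDiffAt.mdifferentiableAt (by simp)
  have h2 := (mdifferentiable_of_mem_maximalAtlas hφ).mdifferentiableAt hp
  have h3 : MDifferentiableAt (𝓡 n) 𝓘(ℝ, ℝ) (fun w : Vec n ↦ w i) (φ p.proj) :=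
    (EuclideanSpace.proj (𝕜 := ℝ) i).hasFDerivAt.hasMFDerivAt.mdifferentiableAt
  have h4 := mfderiv_comp p h3 (h2.comp p h1)
  have h5 := mfderiv_comp p h2 h1
  have h6 : mfderiv (𝓡 n) 𝓘(ℝ, ℝ) (fun w : Vec n ↦ w i) (φ p.proj) = EuclideanSpace.proj i :=
    (EuclideanSpace.proj (𝕜 := ℝ) i).hasFDerivAt.hasMFDerivAt.mfderiv
  rw [h5] at h4
  refine (DFunLike.congr_fun h4 v).trans ?_
  exact DFunLike.congr_fun h6 _

lemma covector_comp_tangentChart (hφ : φ ∈ IsManifold.maximalAtlas (𝓡 n) ∞ M)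
    {p : TangentBundle (𝓡 n) M} (hp : p.proj ∈ φ.source) {U : Vec n × Vec n → ℝ}
    {U' : Vec n × Vec n →L[ℝ] ℝ} (hU : HasFDerivAt U U' (φ p.proj, comp φ p.proj p.snd))
    (v : TangentSpace (𝓡 n).tangent p) :
    covector (𝓡 n).tangent
      (fun q : TangentBundle (𝓡 n) M ↦ U (φ q.proj, comp φ q.proj q.snd)) p v =
      U' (WithLp.toLp 2 fun i ↦ dx φ i p v, WithLp.toLp 2 fun i ↦ dy φ i p v) := by
  have h := (contMDiffAt_tangentChart hφ hp).mdifferentiableAt (by simp)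
  have h2 := mfderiv_comp p hU.hasMFDerivAt.mdifferentiableAt h
  refine (DFunLike.congr_fun h2 v).trans ?_
  refine (DFunLike.congr_fun hU.hasMFDerivAt.mfderiv _).trans ?_
  exact congrArg U' (mfderiv_tangentChart_apply hφ hp v)

lemma hasFDerivAt_comp_fst {u : Vec n → ℝ} {w : Vec n × Vec n} (hu : ContDiffAt ℝ ∞ u w.1) :
    HasFDerivAt (fun w : Vec n × Vec n ↦ u w.1)
      ((fderiv ℝ u w.1) ∘L ContinuousLinearMap.fst ℝ (Vec n) (Vec n)) w :=
  ((hu.differentiableAt (by simp)).hasFDerivAt).comp w hasFDerivAt_fst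

lemma hasFDerivAt_snd_coord (i : Fin n) (w : Vec n × Vec n) :
    HasFDerivAt (fun w : Vec n × Vec n ↦ w.2 i)
      ((EuclideanSpace.proj i) ∘L ContinuousLinearMap.snd ℝ (Vec n) (Vec n)) w :=
  ((EuclideanSpace.proj (𝕜 := ℝ) i) ∘L ContinuousLinearMap.snd ℝ (Vec n) (Vec n)).hasFDerivAt

lemma fderiv_eq_sum_pd (u : Vec n → ℝ) (z c : Vec n) :
    fderiv ℝ u z c = ∑ k, pd k u z * c k := by
  conv_lhs => rw [← sum_smul_stdVec c]
  simp [pd, mul_comm]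

/-! ### Identities between the components -/

/-- The Christoffel symbols of the first kind. -/
def GamLow (g : SemiRiemannMetric n M) (φ : OpenPartialHomeomorph M (Vec n)) (i j k : Fin n)
    (z : Vec n) : ℝ :=
  (1 / 2) * (pd j (gLow g φ i k) z + pd k (gLow g φ i j) z - pd i (gLow g φ j k) z)

lemma pd_gLow_symm (k i j : Fin n) (z : Vec n) : pd k (gLow g φ i j) z = pd k (gLow g φ j i) z := by
  rw [show gLow g φ i j = gLow g φ j i from funext fun z ↦ gLow_symm i j z]

/-- The identity that removes the connection from ω and Ω₂: antisymmetrizing Γ_{j,ik} in i and j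
leaves only first derivatives of g. -/
lemma GamLow_sub (i j k : Fin n) (z : Vec n) :
    GamLow g φ j i k z - GamLow g φ i j k z =
      pd i (gLow g φ j k) z - pd j (gLow g φ i k) z := by
  rw [GamLow, GamLow, pd_gLow_symm k j i]
  ring

lemma sum_gLow_mul_Gam (hφ : φ ∈ IsManifold.maximalAtlas (𝓡 n) ∞ M) {z : Vec n}
    (hz : z ∈ φ.target) (i j k : Fin n) :
    ∑ l, gLow g φ i l z * Gam g φ l j k z = GamLow g φ i j k z := by
  have := sum_gLow_mul_sum_gUp (g := g) hφ hz i fun l ↦ 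
    (pd j (gLow g φ l k) z + pd k (gLow g φ l j) z - pd l (gLow g φ j k) z)
  rw [GamLow, ← this, Finset.mul_sum]
  refine Finset.sum_congr rfl fun l _ ↦ ?_
  rw [Gam]; ring

/-- The partial derivatives of the components of the covector field `g(X, ·)`. -/
def pdXLow (g : SemiRiemannMetric n M) (X : (x : M) → TangentSpace (𝓡 n) x)
    (φ : OpenPartialHomeomorph M (Vec n)) (i j : Fin n) (z : Vec n) : ℝ :=
  ∑ h, (pd i (gLow g φ j h) z * XUp X φ h z + gLow g φ j h z * pd i (XUp X φ h) z)

/-- Lowering an index turns F into ∇_i X_j - ∇_j X_i, where the connection terms reduce to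
derivatives of g. What is left is the differential of the covector field g(X, ·). -/
lemma omegaLow_eq (hφ : φ ∈ IsManifold.maximalAtlas (𝓡 n) ∞ M) {z : Vec n}
    (hz : z ∈ φ.target) (i j : Fin n) :
    omegaLow g X φ i j z = pdXLow g X φ i j z - pdXLow g X φ j i z := by
  have h1 (i j : Fin n) : ∑ h, gLow g φ j h z * nablaX g X φ i h z =
      ∑ h, (gLow g φ j h z * pd i (XUp X φ h) z + GamLow g φ j i h z * XUp X φ h z) := by
    simp_rw [nablaX, mul_add, Finset.sum_add_distrib, ← sum_gLow_mul_Gam hφ hz, Finset.mul_sum,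
      Finset.sum_mul]
    congr 1
    rw [Finset.sum_comm]
    simp_rw [mul_assoc]
  -- The contraction g_{jh} g^{ha} collapses, so the second half of F becomes ∇_j X_i.
  have h2 : ∑ h, gLow g φ j h z * ∑ a, ∑ k, gUp g φ h a z * gLow g φ k i z * nablaX g X φ a k z =
      ∑ k, gLow g φ i k z * nablaX g X φ j k z := by
    have := sum_gLow_mul_sum_gUp (g := g) hφ hz j
      fun a ↦ ∑ k, gLow g φ i k z * nablaX g X φ a k z
    rw [← this]
    simp_rw [Finset.mul_sum, gLow_symm _ i, mul_assoc]
  simp_rw [omegaLow, Fmix, mul_sub, Finset.sum_sub_distrib]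
  rw [h2, h1, h1, pdXLow, pdXLow, ← Finset.sum_sub_distrib, ← Finset.sum_sub_distrib]
  refine Finset.sum_congr rfl fun h _ ↦ ?_
  linear_combination (XUp X φ h z) * GamLow_sub (g := g) (φ := φ) i j h z

lemma omegaLow_antisymm (hφ : φ ∈ IsManifold.maximalAtlas (𝓡 n) ∞ M) {z : Vec n}
    (hz : z ∈ φ.target) (i j : Fin n) : omegaLow g X φ i j z = -omegaLow g X φ j i z := by
  rw [omegaLow_eq hφ hz, omegaLow_eq hφ hz]; ring

/-! ### The form `Ω₂` in coordinates -/

lemma deltay_apply (i : Fin n) (p : TangentBundle (𝓡 n) M) (v : TangentSpace (𝓡 n).tangent p) :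
    deltay g φ i p v =
      dy φ i p v + ∑ h, ∑ k, Gam g φ i h k (φ p.proj) * yCoord φ k p * dx φ h p v := by
  simp [deltay]

/-- Only the antisymmetric part of a coefficient matrix contributes to a sum of wedges. -/
lemma sum_sub_swap (A : Fin n → Fin n → ℝ) (a b : Fin n → ℝ) :
    ∑ i, ∑ j, A i j * (a i * b j - b i * a j) = ∑ i, ∑ j, (A i j - A j i) * (a i * b j) := by
  simp_rw [mul_sub, sub_mul, Finset.sum_sub_distrib]
  congr 1
  rw [Finset.sum_comm]
  exact Finset.sum_congr rfl fun i _ ↦ Finset.sum_congr rfl fun j _ ↦ by ring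

/-- Since ω is antisymmetric, the factor ½ is absorbed by writing dx^i ⊗ dx^j for the wedge. -/
lemma omegaTwoInChart_apply (hφ : φ ∈ IsManifold.maximalAtlas (𝓡 n) ∞ M)
    {p : TangentBundle (𝓡 n) M} (hp : p.proj ∈ φ.source)
    (v : Fin 2 → TangentSpace (𝓡 n).tangent p) :
    omegaTwoInChart g X φ p v =
      ∑ i, ∑ j, omegaLow g X φ i j (φ p.proj) * (dx φ i p (v 0) * dx φ j p (v 1)) +
      ∑ i, ∑ j, gLow g φ i j (φ p.proj) *
        (dx φ i p (v 0) * deltay g φ j p (v 1) - dx φ i p (v 1) * deltay g φ j p (v 0)) := by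
  have h1 : omegaTwoInChart g X φ p v = (1 / 2) * ∑ i, ∑ j, omegaLow g X φ i j (φ p.proj) *
        (dx φ i p (v 0) * dx φ j p (v 1) - dx φ i p (v 1) * dx φ j p (v 0)) +
      ∑ i, ∑ j, gLow g φ i j (φ p.proj) *
        (dx φ i p (v 0) * deltay g φ j p (v 1) - dx φ i p (v 1) * deltay g φ j p (v 0)) := by
    simp [omegaTwoInChart]
  rw [h1, sum_sub_swap]
  congr 1
  simp_rw [Finset.mul_sum]
  refine Finset.sum_congr rfl fun i _ ↦ Finset.sum_congr rfl fun j _ ↦ ?_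
  rw [omegaLow_antisymm hφ (φ.map_source hp) j i]
  ring

lemma sum_gLow_mul_deltay (hφ : φ ∈ IsManifold.maximalAtlas (𝓡 n) ∞ M)
    {p : TangentBundle (𝓡 n) M} (hp : p.proj ∈ φ.source) (v : TangentSpace (𝓡 n).tangent p)
    (i : Fin n) :
    ∑ j, gLow g φ i j (φ p.proj) * deltay g φ j p v = ∑ j, gLow g φ i j (φ p.proj) * dy φ j p v +
      ∑ h, (∑ k, GamLow g φ i h k (φ p.proj) * yCoord φ k p) * dx φ h p v := by
  simp_rw [deltay_apply, mul_add, Finset.sum_add_distrib, ← sum_gLow_mul_Gam hφ (φ.map_source hp),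
    Finset.mul_sum, Finset.sum_mul]
  congr 1
  rw [Finset.sum_comm]
  refine Finset.sum_congr rfl fun h _ ↦ ?_
  rw [Finset.sum_comm]
  refine Finset.sum_congr rfl fun k _ ↦ Finset.sum_congr rfl fun j _ ↦ ?_
  ring

/-- The components `a_j = g_{ij} (y^i - X^i)` of `η₂`. -/
def etaCoeff (g : SemiRiemannMetric n M) (X : (x : M) → TangentSpace (𝓡 n) x)
    (φ : OpenPartialHomeomorph M (Vec n)) (j : Fin n) (p : TangentBundle (𝓡 n) M) : ℝ :=
  ∑ i, gLow g φ j i (φ p.proj) * (yCoord φ i p - XUp X φ i (φ p.proj))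

lemma etaTwoInChart_eq (p : TangentBundle (𝓡 n) M) :
    etaTwoInChart g X φ p = oneForm (∑ j, etaCoeff g X φ j p • dx φ j p) := by
  have h (a b : TangentSpace (𝓡 n).tangent p →L[ℝ] ℝ) (h : a = b) : oneForm a = oneForm b :=
    congrArg _ h
  refine h _ _ ?_
  ext v
  simp only [etaCoeff, add_apply, neg_apply, sum_apply, smul_apply, smul_eq_mul, Finset.sum_mul]
  rw [neg_add_eq_sub, ← Finset.sum_sub_distrib]
  simp_rw [← Finset.sum_sub_distrib]
  rw [Finset.sum_comm]
  refine Finset.sum_congr rfl fun i _ ↦ Finset.sum_congr rfl fun j _ ↦ ?_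
  rw [gLow_symm i j]
  ring

/-- The intrinsic form of η₂; no chart occurs on the right, which gives chart independence. -/
lemma etaTwoInChart_apply (hφ : φ ∈ IsManifold.maximalAtlas (𝓡 n) ∞ M)
    {p : TangentBundle (𝓡 n) M} (hp : p.proj ∈ φ.source)
    (v : Fin 1 → TangentSpace (𝓡 n).tangent p) :
    etaTwoInChart g X φ p v = g.inner p.proj (p.snd - X p.proj)
      (mfderiv (𝓡 n).tangent (𝓡 n) TotalSpace.proj p (v 0)) := by
  have hsub (i : Fin n) : comp φ p.proj (p.snd - X p.proj) i =
      yCoord φ i p - XUp X φ i (φ p.proj) := by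
    have h1 : comp φ p.proj (p.snd - X p.proj) = comp φ p.proj p.snd - comp φ p.proj (X p.proj) :=
      map_sub (mfderiv (𝓡 n) (𝓡 n) φ p.proj) _ _
    rw [h1, XUp, φ.left_inv hp]
    rfl
  rw [etaTwoInChart_eq, oneForm_apply, inner_eq_sum hφ hp, sum_apply, Finset.sum_comm]
  refine Finset.sum_congr rfl fun j _ ↦ ?_
  rw [smul_apply, etaCoeff, smul_eq_mul, Finset.sum_mul]
  refine Finset.sum_congr rfl fun i _ ↦ ?_
  rw [dx_apply hφ hp, hsub, gLow_symm j i]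

lemma chart_mem (x : M) : chartAt (Vec n) x ∈ IsManifold.maximalAtlas (𝓡 n) ∞ M :=
  IsManifold.chart_mem_maximalAtlas x

lemma etaTwo_eq (hφ : φ ∈ IsManifold.maximalAtlas (𝓡 n) ∞ M)
    {p : TangentBundle (𝓡 n) M} (hp : p.proj ∈ φ.source) :
    etaTwo g X p = etaTwoInChart g X φ p := by
  ext v
  rw [etaTwoInChart_apply hφ hp, etaTwo, etaTwoInChart_apply (chart_mem _) (mem_chart_source _ _)]

lemma isLocalSum_etaTwo (hX : ContMDiff (𝓡 n) (𝓡 n).tangent ∞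
      (fun x ↦ (⟨x, X x⟩ : TangentBundle (𝓡 n) M)))
    (hφ : φ ∈ IsManifold.maximalAtlas (𝓡 n) ∞ M) :
    IsLocalSum (etaTwo g X) (etaCoeff g X φ) (fun i (q : TangentBundle (𝓡 n) M) ↦ φ q.proj i)
      (TotalSpace.proj ⁻¹' φ.source) where
  isOpen := φ.open_source.preimage (FiberBundle.continuous_proj (Vec n) (TangentSpace (𝓡 n)))
  left j p hp := by
    have hz := φ.map_source hp
    have h : ContDiffAt ℝ ∞ (fun w : Vec n × Vec n ↦ ∑ i, gLow g φ j i w.1 *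
        (w.2 i - XUp X φ i w.1)) (φ p.proj, comp φ p.proj p.snd) := by
      refine ContDiffAt.sum fun i _ ↦ ContDiffAt.mul ?_ (ContDiffAt.sub ?_ ?_)
      · exact (contDiffAt_gLow hφ hz j i).fst''
      · exact (EuclideanSpace.proj (𝕜 := ℝ) i).contDiff.contDiffAt.comp _ contDiffAt_snd
      · exact (contDiffAt_XUp hX hφ hz i).fst''
    exact ContDiffAt.comp_contMDiffAt
      (f := fun q : TangentBundle (𝓡 n) M ↦ (φ q.proj, comp φ q.proj q.snd)) h
      (contMDiffAt_tangentChart hφ hp)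
  right i p hp := contMDiffAt_coord hφ hp i
  eq p hp := by rw [etaTwo_eq hφ hp, etaTwoInChart_eq]; rfl

lemma covector_etaCoeff (hX : ContMDiff (𝓡 n) (𝓡 n).tangent ∞
      (fun x ↦ (⟨x, X x⟩ : TangentBundle (𝓡 n) M)))
    (hφ : φ ∈ IsManifold.maximalAtlas (𝓡 n) ∞ M)
    {p : TangentBundle (𝓡 n) M} (hp : p.proj ∈ φ.source) (j : Fin n)
    (v : TangentSpace (𝓡 n).tangent p) :
    covector (𝓡 n).tangent (etaCoeff g X φ j) p v =
      ∑ i, gLow g φ j i (φ p.proj) * dy φ i p v +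
      ∑ h, (∑ k, pd h (gLow g φ j k) (φ p.proj) * yCoord φ k p - pdXLow g X φ h j (φ p.proj)) *
        dx φ h p v := by
  have hz := φ.map_source hp
  have h1 := HasFDerivAt.fun_sum (u := Finset.univ) fun i (_ : i ∈ Finset.univ) ↦
    (hasFDerivAt_comp_fst (w := (φ p.proj, comp φ p.proj p.snd)) (contDiffAt_gLow (g := g) hφ hz j i)).mul
      ((hasFDerivAt_snd_coord i _).sub (hasFDerivAt_comp_fst (contDiffAt_XUp hX hφ hz i)))
  refine (covector_comp_tangentChart hφ hp h1 v).trans ?_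
  rw [sum_apply]
  calc _ = ∑ i, (gLow g φ j i (φ p.proj) * (dy φ i p v - ∑ h, pd h (XUp X φ i) (φ p.proj) *
          dx φ h p v) + (yCoord φ i p - XUp X φ i (φ p.proj)) *
          ∑ h, pd h (gLow g φ j i) (φ p.proj) * dx φ h p v) := by
        refine Finset.sum_congr rfl fun i _ ↦ ?_
        rw [← fderiv_eq_sum_pd _ _ (WithLp.toLp 2 fun i ↦ dx φ i p v),
          ← fderiv_eq_sum_pd _ _ (WithLp.toLp 2 fun i ↦ dx φ i p v)]
        rfl
    _ = ∑ i, (gLow g φ j i (φ p.proj) * dy φ i p v + ∑ h, (pd h (gLow g φ j i) (φ p.proj) *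
          yCoord φ i p - (pd h (gLow g φ j i) (φ p.proj) * XUp X φ i (φ p.proj) +
          gLow g φ j i (φ p.proj) * pd h (XUp X φ i) (φ p.proj))) * dx φ h p v) := by
        refine Finset.sum_congr rfl fun i _ ↦ ?_
        rw [mul_sub, sub_add, Finset.mul_sum, Finset.mul_sum, ← Finset.sum_sub_distrib,
          sub_eq_add_neg, ← Finset.sum_neg_distrib]
        congr 1
        exact Finset.sum_congr rfl fun h _ ↦ by ring
    _ = _ := by
        rw [Finset.sum_add_distrib, Finset.sum_comm]
        simp_rw [pdXLow, ← Finset.sum_sub_distrib, Finset.sum_mul]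

lemma omegaTwoInChart_eq_neg_sumWedge (hX : ContMDiff (𝓡 n) (𝓡 n).tangent ∞
      (fun x ↦ (⟨x, X x⟩ : TangentBundle (𝓡 n) M)))
    (hφ : φ ∈ IsManifold.maximalAtlas (𝓡 n) ∞ M)
    {p : TangentBundle (𝓡 n) M} (hp : p.proj ∈ φ.source) :
    omegaTwoInChart g X φ p =
      -sumWedge (etaCoeff g X φ) (fun i (q : TangentBundle (𝓡 n) M) ↦ φ q.proj i) p := by
  ext v
  have hz := φ.map_source hp
  -- D is the dx-part of da_j once g_{jk} δy^k is split off. Its antisymmetric part, the only one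
  -- that enters the wedge sum, is ω (`h2`): the terms in y cancel by `GamLow_sub`, and the terms in
  -- X are those of `omegaLow_eq`.
  set D : Fin n → Fin n → ℝ := fun j h ↦
    (∑ k, pd h (gLow g φ j k) (φ p.proj) * yCoord φ k p - pdXLow g X φ h j (φ p.proj)) -
      ∑ k, GamLow g φ j h k (φ p.proj) * yCoord φ k p with hD
  have h1 (j : Fin n) (i : Fin 2) : covector (𝓡 n).tangent (etaCoeff g X φ j) p (v i) =
      ∑ k, gLow g φ j k (φ p.proj) * deltay g φ k p (v i) + ∑ h, D j h * dx φ h p (v i) := by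
    rw [covector_etaCoeff hX hφ hp, sum_gLow_mul_deltay hφ hp, add_assoc]
    congr 1
    rw [← Finset.sum_add_distrib]
    exact Finset.sum_congr rfl fun h _ ↦ by rw [hD]; ring
  have h2 (i j : Fin n) : D i j - D j i = omegaLow g X φ i j (φ p.proj) := by
    have h3 : ∑ k, pd j (gLow g φ i k) (φ p.proj) * yCoord φ k p -
        ∑ k, pd i (gLow g φ j k) (φ p.proj) * yCoord φ k p +
        ∑ k, GamLow g φ j i k (φ p.proj) * yCoord φ k p -
        ∑ k, GamLow g φ i j k (φ p.proj) * yCoord φ k p = 0 := by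
      rw [← Finset.sum_sub_distrib, ← Finset.sum_add_distrib, ← Finset.sum_sub_distrib]
      refine Finset.sum_eq_zero fun k _ ↦ ?_
      linear_combination yCoord φ k p * GamLow_sub (g := g) (φ := φ) i j k (φ p.proj)
    rw [omegaLow_eq hφ hz, hD]
    linear_combination h3
  have h4 (i : Fin n) (w : TangentSpace (𝓡 n).tangent p) :
      covector (𝓡 n).tangent (fun q : TangentBundle (𝓡 n) M ↦ φ q.proj i) p w = dx φ i p w := rfl
  rw [omegaTwoInChart_apply hφ hp, ContinuousAlternatingMap.neg_apply, sumWedge_apply,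
    ← Finset.sum_neg_distrib]
  simp_rw [← h2, ← sum_sub_swap, h1, h4]
  rw [← Finset.sum_add_distrib]
  refine Finset.sum_congr rfl fun i _ ↦ ?_
  simp_rw [mul_sub, Finset.sum_sub_distrib, add_mul, Finset.sum_mul]
  simp only [mul_left_comm _ (dx φ i p _), mul_comm _ (dx φ i p _)]
  ring

/-! ### The global statements about `Ω₂` and `η₂` -/

/-- The right side does not involve φ, so chart independence of Ω₂ comes from that of η₂. -/
lemma omegaTwoInChart_eq (hX : ContMDiff (𝓡 n) (𝓡 n).tangent ∞
      (fun x ↦ (⟨x, X x⟩ : TangentBundle (𝓡 n) M)))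
    (hφ : φ ∈ IsManifold.maximalAtlas (𝓡 n) ∞ M)
    {p : TangentBundle (𝓡 n) M} (hp : p.proj ∈ φ.source) :
    omegaTwoInChart g X φ p = -extDerivForm (𝓡 n).tangent (etaTwo g X) p := by
  rw [(isLocalSum_etaTwo hX hφ).extDerivForm hp, omegaTwoInChart_eq_neg_sumWedge hX hφ hp]

lemma omegaTwo_eq_neg_extDerivForm (hX : ContMDiff (𝓡 n) (𝓡 n).tangent ∞
      (fun x ↦ (⟨x, X x⟩ : TangentBundle (𝓡 n) M))) (p : TangentBundle (𝓡 n) M) :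
    omegaTwo g X p = -extDerivForm (𝓡 n).tangent (etaTwo g X) p :=
  omegaTwoInChart_eq hX (chart_mem _) (mem_chart_source _ _)

lemma omegaTwo_eq (hX : ContMDiff (𝓡 n) (𝓡 n).tangent ∞
      (fun x ↦ (⟨x, X x⟩ : TangentBundle (𝓡 n) M)))
    (hφ : φ ∈ IsManifold.maximalAtlas (𝓡 n) ∞ M)
    {p : TangentBundle (𝓡 n) M} (hp : p.proj ∈ φ.source) :
    omegaTwo g X p = omegaTwoInChart g X φ p :=
  (omegaTwo_eq_neg_extDerivForm hX p).trans (omegaTwoInChart_eq hX hφ hp).symm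

lemma omegaTwo_nondegenerate (hX : ContMDiff (𝓡 n) (𝓡 n).tangent ∞
      (fun x ↦ (⟨x, X x⟩ : TangentBundle (𝓡 n) M))) (p : TangentBundle (𝓡 n) M)
    (v : TangentSpace (𝓡 n).tangent p)
    (h : ∀ w : TangentSpace (𝓡 n).tangent p, omegaTwo g X p ![v, w] = 0) : v = 0 := by
  set φ := chartAt (Vec n) p.proj
  have hφ : φ ∈ IsManifold.maximalAtlas (𝓡 n) ∞ M := chart_mem _
  have hp : p.proj ∈ φ.source := mem_chart_source _ _
  have hz := φ.map_source hp
  have key (a b : Fin n → ℝ) :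
      ∑ i, ∑ j, omegaLow g X φ i j (φ p.proj) * (dx φ i p v * a j) +
      ∑ i, ∑ j, gLow g φ i j (φ p.proj) *
        (dx φ i p v * b j - a i * deltay g φ j p v) = 0 := by
    -- The test vector should have dx = a and δy = b, so its dy-components are b corrected by the
    -- connection term.
    obtain ⟨w, hw1, hw2⟩ := exists_dx_dy hφ hp a
      fun j ↦ b j - ∑ h, ∑ k, Gam g φ j h k (φ p.proj) * yCoord φ k p * a h
    have hw3 (j : Fin n) : deltay g φ j p w = b j := by
      simp only [deltay_apply, hw1, hw2]; ring
    have := h w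
    rw [omegaTwo_eq hX hφ hp, omegaTwoInChart_apply hφ hp] at this
    simpa only [Matrix.cons_val_zero, Matrix.cons_val_one, hw1, hw3] using this
  -- Vectors with dx = 0 see only the block g, which forces dx(v) = 0; after that, vectors with δy =
  -- 0 force δy(v) = 0.
  have hx : (fun i ↦ dx φ i p v) = 0 := by
    refine eq_zero_of_sum_gLow (g := g) hφ hz fun i ↦ ?_
    have := key 0 (Pi.single i 1)
    simp only [Pi.zero_apply, mul_zero, zero_mul, sub_zero, Finset.sum_const_zero, zero_add,
      Pi.single_apply, mul_ite, mul_one, Finset.sum_ite_eq', Finset.mem_univ, if_true] at this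
    simpa only [gLow_symm i] using this
  have hx' (i : Fin n) : dx φ i p v = 0 := congrFun hx i
  have hy : (fun i ↦ deltay g φ i p v) = 0 := by
    refine eq_zero_of_sum_gLow (g := g) hφ hz fun i ↦ ?_
    have := key (Pi.single i 1) 0
    simp only [hx', Pi.single_apply, zero_mul, mul_zero, zero_sub, ite_mul, one_mul, mul_neg,
      Finset.sum_neg_distrib, mul_ite] at this
    rw [Finset.sum_comm] at this
    simpa using this
  refine dx_dy_ext hφ hp (fun i ↦ by rw [hx', map_zero]) fun i ↦ ?_
  have := congrFun hy i
  simp only [deltay_apply, hx', mul_zero, Finset.sum_const_zero, add_zero] at this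
  rw [map_zero]
  exact this

lemma isSymplectic_omegaTwo (hX : ContMDiff (𝓡 n) (𝓡 n).tangent ∞
      (fun x ↦ (⟨x, X x⟩ : TangentBundle (𝓡 n) M))) :
    IsSymplectic (𝓡 n).tangent (omegaTwo g X) ∧ IsSmoothForm (𝓡 n).tangent (etaTwo g X) := by
  obtain ⟨h1, h2, h3⟩ := IsSmoothForm.neg_extDerivForm
    (fun p : TangentBundle (𝓡 n) M ↦ mem_chart_source (Vec n) p.proj)
    (fun p ↦ isLocalSum_etaTwo (g := g) hX (chart_mem p.proj)) (omegaTwo_eq_neg_extDerivForm hX)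
  exact ⟨⟨h2, h3, omegaTwo_nondegenerate hX⟩, h1⟩

end Differentials

/-! ### The Hamilton vector field and its components. -/

section Hamilton

variable {n : ℕ} {M : Type*} [TopologicalSpace M] [ChartedSpace (Vec n) M] [IsManifold (𝓡 n) ∞ M]
  {g : SemiRiemannMetric n M} {X : (x : M) → TangentSpace (𝓡 n) x}
  {φ : OpenPartialHomeomorph M (Vec n)}

/-- Metric compatibility in coordinates: replacing dy by δy absorbs exactly the derivatives of g,
because ½ ∂_h g_{ik} y^i y^k = Γ_{i,hk} y^i y^k. -/
lemma covector_hamiltonian (hX : ContMDiff (𝓡 n) (𝓡 n).tangent ∞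
      (fun x ↦ (⟨x, X x⟩ : TangentBundle (𝓡 n) M)))
    (hφ : φ ∈ IsManifold.maximalAtlas (𝓡 n) ∞ M)
    {p : TangentBundle (𝓡 n) M} (hp : p.proj ∈ φ.source) (v : TangentSpace (𝓡 n).tangent p) :
    covector (𝓡 n).tangent (hamiltonian g X) p v =
      ∑ i, ∑ j, gLow g φ i j (φ p.proj) * (yCoord φ i p * deltay g φ j p v) -
        ∑ k, pd k (fun w ↦ energy g X (φ.symm w)) (φ p.proj) * dx φ k p v := by
  have hz := φ.map_source hp
  set w₀ : Vec n × Vec n := (φ p.proj, comp φ p.proj p.snd) with hw₀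
  have hev : hamiltonian g X =ᶠ[nhds p] fun q : TangentBundle (𝓡 n) M ↦
      (fun w : Vec n × Vec n ↦ (1 / 2 : ℝ) * (∑ i, ∑ j, gLow g φ i j w.1 * (w.2 i * w.2 j)) -
        energy g X (φ.symm w.1)) (φ q.proj, comp φ q.proj q.snd) := by
    filter_upwards [(φ.open_source.preimage
      (FiberBundle.continuous_proj (Vec n) (TangentSpace (𝓡 n)))).mem_nhds hp] with q hq
    simp only [hamiltonian, φ.left_inv hq, inner_eq_sum hφ hq, mul_assoc]
  have h1 := ((HasFDerivAt.fun_sum (u := Finset.univ) fun i (_ : i ∈ Finset.univ) ↦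
    HasFDerivAt.fun_sum (u := Finset.univ) fun j (_ : j ∈ Finset.univ) ↦
      (hasFDerivAt_comp_fst (w := w₀) (contDiffAt_gLow (g := g) hφ hz i j)).mul
        ((hasFDerivAt_snd_coord i w₀).mul (hasFDerivAt_snd_coord j w₀))).const_mul (1 / 2 : ℝ)).sub
    (hasFDerivAt_comp_fst (w := w₀) (contDiffAt_energy_symm (g := g) hX hφ hz))
  have h2 := covector_comp_tangentChart hφ hp h1 v
  have h3 : covector (𝓡 n).tangent (hamiltonian g X) p v = covector (𝓡 n).tangent
      (fun q : TangentBundle (𝓡 n) M ↦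
        (fun w : Vec n × Vec n ↦ (1 / 2 : ℝ) * (∑ i, ∑ j, gLow g φ i j w.1 * (w.2 i * w.2 j)) -
        energy g X (φ.symm w.1)) (φ q.proj, comp φ q.proj q.snd)) p v :=
    DFunLike.congr_fun hev.mfderiv_eq v
  refine h3.trans (h2.trans ?_)
  have hE := fderiv_eq_sum_pd (fun w ↦ energy g X (φ.symm w)) (φ p.proj)
    (WithLp.toLp 2 fun i ↦ dx φ i p v)
  have hg (i j : Fin n) := fderiv_eq_sum_pd (gLow g φ i j) (φ p.proj)
    (WithLp.toLp 2 fun i ↦ dx φ i p v)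
  rw [sub_apply]
  refine congrArg₂ (· - ·) ?_ hE
  rw [smul_apply, sum_apply, smul_eq_mul]
  set y : Fin n → ℝ := fun i ↦ yCoord φ i p with hy
  have hA : ∑ i, ∑ j, gLow g φ i j (φ p.proj) * (y i * deltay g φ j p v) =
      ∑ i, ∑ j, gLow g φ i j (φ p.proj) * (y i * dy φ j p v) +
      ∑ h, (∑ i, ∑ k, GamLow g φ i h k (φ p.proj) * y k * y i) * dx φ h p v := by
    have h4 (i : Fin n) := sum_gLow_mul_deltay (g := g) hφ hp v i
    simp_rw [mul_left_comm _ (y _), ← Finset.mul_sum, h4, mul_add, Finset.sum_add_distrib]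
    congr 1
    simp_rw [Finset.sum_mul, Finset.mul_sum]
    rw [Finset.sum_comm]
    refine Finset.sum_congr rfl fun h _ ↦ Finset.sum_congr rfl fun i _ ↦ ?_
    exact Finset.sum_congr rfl fun k _ ↦ by simp only [hy]; ring
  -- Contracted with the symmetric y^i y^k, the last two terms of Γ_{i,hk} cancel.
  have hB (h : Fin n) : ∑ i, ∑ k, GamLow g φ i h k (φ p.proj) * y k * y i =
      (1 / 2) * ∑ i, ∑ k, pd h (gLow g φ i k) (φ p.proj) * (y i * y k) := by
    have h5 : ∑ i, ∑ k, pd k (gLow g φ i h) (φ p.proj) * (y i * y k) =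
        ∑ i, ∑ k, pd i (gLow g φ h k) (φ p.proj) * (y i * y k) := by
      rw [Finset.sum_comm]
      refine Finset.sum_congr rfl fun i _ ↦ Finset.sum_congr rfl fun k _ ↦ ?_
      rw [pd_gLow_symm]; ring
    calc _ = (1 / 2) * (∑ i, ∑ k, pd h (gLow g φ i k) (φ p.proj) * (y i * y k) +
          ∑ i, ∑ k, pd k (gLow g φ i h) (φ p.proj) * (y i * y k) -
          ∑ i, ∑ k, pd i (gLow g φ h k) (φ p.proj) * (y i * y k)) := by
          simp_rw [← Finset.sum_add_distrib, ← Finset.sum_sub_distrib, Finset.mul_sum]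
          refine Finset.sum_congr rfl fun i _ ↦ Finset.sum_congr rfl fun k _ ↦ ?_
          rw [GamLow]; ring
      _ = _ := by rw [h5]; ring
  rw [hA]
  simp_rw [hB]
  have hC : ∑ i, ∑ j, gLow g φ i j (φ p.proj) * (y i * dy φ j p v) =
      ∑ i, ∑ j, gLow g φ i j (φ p.proj) * (y j * dy φ i p v) := by
    rw [Finset.sum_comm]
    refine Finset.sum_congr rfl fun i _ ↦ Finset.sum_congr rfl fun k _ ↦ ?_
    rw [gLow_symm]
  calc _ = (1 / 2) * ∑ i, ∑ j, (gLow g φ i j (φ p.proj) * (y i * dy φ j p v + y j * dy φ i p v) +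
          (y i * y j) * ∑ h, pd h (gLow g φ i j) (φ p.proj) * dx φ h p v) := by
        congr 1
        refine Finset.sum_congr rfl fun i _ ↦ ?_
        rw [sum_apply]
        refine Finset.sum_congr rfl fun j _ ↦ ?_
        rw [← hg i j]
        rfl
    _ = (1 / 2) * (∑ i, ∑ j, gLow g φ i j (φ p.proj) * (y i * dy φ j p v) +
          ∑ i, ∑ j, gLow g φ i j (φ p.proj) * (y j * dy φ i p v) +
          ∑ h, (∑ i, ∑ k, pd h (gLow g φ i k) (φ p.proj) * (y i * y k)) * dx φ h p v) := by
        have h6 : ∑ h, (∑ i, ∑ k, pd h (gLow g φ i k) (φ p.proj) * (y i * y k)) * dx φ h p v =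
            ∑ i, ∑ j, (y i * y j) * ∑ h, pd h (gLow g φ i j) (φ p.proj) * dx φ h p v := by
          simp_rw [Finset.sum_mul, Finset.mul_sum]
          rw [Finset.sum_comm]
          refine Finset.sum_congr rfl fun i _ ↦ ?_
          rw [Finset.sum_comm]
          exact Finset.sum_congr rfl fun j _ ↦ Finset.sum_congr rfl fun h _ ↦ by ring
        rw [h6]
        simp_rw [← Finset.sum_add_distrib, mul_add]
    _ = _ := by
        rw [← hC]
        simp_rw [mul_assoc, ← Finset.mul_sum]
        ring

/-- The right-hand side of `(x^i)'' = …` in the system, as a function of `(x, y)`. -/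
def accel (g : SemiRiemannMetric n M) (X : (x : M) → TangentSpace (𝓡 n) x)
    (φ : OpenPartialHomeomorph M (Vec n)) (i : Fin n) (w : Vec n × Vec n) : ℝ :=
  gradEnergy g X φ i w.1 + ∑ j, Fmix g X φ j i w.1 * w.2 j -
    ∑ j, ∑ k, Gam g φ i j k w.1 * w.2 j * w.2 k

lemma contDiffAt_accel (hX : ContMDiff (𝓡 n) (𝓡 n).tangent ∞
      (fun x ↦ (⟨x, X x⟩ : TangentBundle (𝓡 n) M)))
    (hφ : φ ∈ IsManifold.maximalAtlas (𝓡 n) ∞ M) {w : Vec n × Vec n} (hw : w.1 ∈ φ.target)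
    (i : Fin n) : ContDiffAt ℝ ∞ (accel g X φ i) w := by
  have hs (j : Fin n) : ContDiffAt ℝ ∞ (fun w : Vec n × Vec n ↦ w.2 j) w :=
    (EuclideanSpace.proj (𝕜 := ℝ) j).contDiff.contDiffAt.comp _ contDiffAt_snd
  refine ((contDiffAt_gradEnergy hX hφ hw i).fst''.add
    (ContDiffAt.sum fun j _ ↦ (contDiffAt_Fmix hX hφ hw j i).fst''.mul (hs j))).sub
    (ContDiffAt.sum fun j _ ↦ ContDiffAt.sum fun k _ ↦
      ((contDiffAt_Gam hφ hw i j k).fst''.mul (hs j)).mul (hs k))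

/-- A tangent vector with components `(y, accel)` is a Hamilton gradient at its base point. -/
lemma omegaTwo_eq_covector_hamiltonian (hX : ContMDiff (𝓡 n) (𝓡 n).tangent ∞
      (fun x ↦ (⟨x, X x⟩ : TangentBundle (𝓡 n) M)))
    (hφ : φ ∈ IsManifold.maximalAtlas (𝓡 n) ∞ M)
    {p : TangentBundle (𝓡 n) M} (hp : p.proj ∈ φ.source) {v : TangentSpace (𝓡 n).tangent p}
    (h1 : ∀ i, dx φ i p v = yCoord φ i p)
    (h2 : ∀ i, dy φ i p v = accel g X φ i (φ p.proj, comp φ p.proj p.snd))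
    (w : TangentSpace (𝓡 n).tangent p) :
    omegaTwo g X p ![v, w] = covector (𝓡 n).tangent (hamiltonian g X) p w := by
  have hz := φ.map_source hp
  have hδ (j : Fin n) : deltay g φ j p v =
      gradEnergy g X φ j (φ p.proj) + ∑ k, Fmix g X φ k j (φ p.proj) * yCoord φ k p := by
    rw [deltay_apply, h2, accel]
    simp_rw [h1]
    have e : ∑ h, ∑ k, Gam g φ j h k (φ p.proj) * yCoord φ k p * yCoord φ h p =
        ∑ h, ∑ k, Gam g φ j h k (φ p.proj) * yCoord φ h p * yCoord φ k p :=
      Finset.sum_congr rfl fun h _ ↦ Finset.sum_congr rfl fun k _ ↦ by ring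
    rw [e]
    exact sub_add_cancel _ _
  -- Lowering the index of grad f + F y gives df and ω(y, ·); the latter cancels the ω-block of Ω₂
  -- below.
  have hg (i : Fin n) : ∑ j, gLow g φ i j (φ p.proj) * deltay g φ j p v =
      pd i (fun w ↦ energy g X (φ.symm w)) (φ p.proj) +
        ∑ k, omegaLow g X φ k i (φ p.proj) * yCoord φ k p := by
    simp_rw [hδ, mul_add, Finset.sum_add_distrib, gradEnergy, sum_gLow_mul_sum_gUp hφ hz, omegaLow,
      Finset.mul_sum, Finset.sum_mul]
    congr 1
    rw [Finset.sum_comm]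
    exact Finset.sum_congr rfl fun h _ ↦ Finset.sum_congr rfl fun k _ ↦ by ring
  rw [omegaTwo_eq hX hφ hp, omegaTwoInChart_apply hφ hp, covector_hamiltonian hX hφ hp]
  simp only [Matrix.cons_val_zero, Matrix.cons_val_one, h1]
  have e : ∑ i, ∑ j, gLow g φ i j (φ p.proj) *
      (yCoord φ i p * deltay g φ j p w - dx φ i p w * deltay g φ j p v) =
      ∑ i, ∑ j, gLow g φ i j (φ p.proj) * (yCoord φ i p * deltay g φ j p w) -
      ∑ i, dx φ i p w * ∑ j, gLow g φ i j (φ p.proj) * deltay g φ j p v := by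
    simp_rw [mul_sub, Finset.sum_sub_distrib, Finset.mul_sum, mul_left_comm (dx φ _ p w)]
  have e2 : ∑ i, ∑ j, omegaLow g X φ i j (φ p.proj) * (yCoord φ i p * dx φ j p w) =
      ∑ i, dx φ i p w * ∑ k, omegaLow g X φ k i (φ p.proj) * yCoord φ k p := by
    rw [Finset.sum_comm]
    simp_rw [Finset.mul_sum]
    exact Finset.sum_congr rfl fun h _ ↦ Finset.sum_congr rfl fun k _ ↦ by ring
  rw [e, e2]
  simp_rw [hg, mul_add, Finset.sum_add_distrib, mul_comm (dx φ _ p w)]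
  ring

lemma hamilton_unique (hX : ContMDiff (𝓡 n) (𝓡 n).tangent ∞
      (fun x ↦ (⟨x, X x⟩ : TangentBundle (𝓡 n) M)))
    {p : TangentBundle (𝓡 n) M} {v v' : TangentSpace (𝓡 n).tangent p}
    (h : ∀ w : TangentSpace (𝓡 n).tangent p, omegaTwo g X p ![v, w] = omegaTwo g X p ![v', w]) :
    v = v' := by
  refine sub_eq_zero.1 (omegaTwo_nondegenerate (g := g) hX p _ fun w ↦ ?_)
  have h1 := (omegaTwo g X p).map_update_sub ![v, w] 0 v v'
  have h2 (u : TangentSpace (𝓡 n).tangent p) : Function.update ![v, w] 0 u = ![u, w] := by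
    funext i; fin_cases i <;> rfl
  rw [h2, h2, h2] at h1
  rw [h1, h, sub_self]

/-- The Hamilton vector field `X_H`. -/
def hamField (g : SemiRiemannMetric n M) (X : (x : M) → TangentSpace (𝓡 n) x)
    (p : TangentBundle (𝓡 n) M) : TangentSpace (𝓡 n).tangent p :=
  (exists_dx_dy (chart_mem p.proj) (mem_chart_source _ _)
    (fun i ↦ yCoord (chartAt (Vec n) p.proj) i p)
    (fun i ↦ accel g X (chartAt (Vec n) p.proj) i
      (chartAt (Vec n) p.proj p.proj, comp (chartAt (Vec n) p.proj) p.proj p.snd))).choose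

lemma omegaTwo_hamField (hX : ContMDiff (𝓡 n) (𝓡 n).tangent ∞
      (fun x ↦ (⟨x, X x⟩ : TangentBundle (𝓡 n) M)))
    (p : TangentBundle (𝓡 n) M) (w : TangentSpace (𝓡 n).tangent p) :
    omegaTwo g X p ![hamField g X p, w] = covector (𝓡 n).tangent (hamiltonian g X) p w := by
  have h := (exists_dx_dy (chart_mem p.proj) (mem_chart_source _ _)
    (fun i ↦ yCoord (chartAt (Vec n) p.proj) i p)
    (fun i ↦ accel g X (chartAt (Vec n) p.proj) i
      (chartAt (Vec n) p.proj p.proj, comp (chartAt (Vec n) p.proj) p.proj p.snd))).choose_spec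
  exact omegaTwo_eq_covector_hamiltonian hX (chart_mem p.proj) (mem_chart_source _ _) h.1 h.2 w

lemma isHamiltonGradient_iff (hX : ContMDiff (𝓡 n) (𝓡 n).tangent ∞
      (fun x ↦ (⟨x, X x⟩ : TangentBundle (𝓡 n) M)))
    (W : (p : TangentBundle (𝓡 n) M) → TangentSpace (𝓡 n).tangent p) :
    IsHamiltonGradient (𝓡 n).tangent (omegaTwo g X) (hamiltonian g X) W ↔ W = hamField g X := by
  constructor
  · intro h
    funext p
    exact hamilton_unique hX fun w ↦ (h p w).trans (omegaTwo_hamField hX p w).symm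
  · rintro rfl p w
    exact omegaTwo_hamField hX p w

/-- In every chart the Hamilton vector field has the components `(y, accel)`. -/
lemma dx_dy_hamField (hX : ContMDiff (𝓡 n) (𝓡 n).tangent ∞
      (fun x ↦ (⟨x, X x⟩ : TangentBundle (𝓡 n) M)))
    (hφ : φ ∈ IsManifold.maximalAtlas (𝓡 n) ∞ M)
    {p : TangentBundle (𝓡 n) M} (hp : p.proj ∈ φ.source) (i : Fin n) :
    dx φ i p (hamField g X p) = yCoord φ i p ∧
      dy φ i p (hamField g X p) = accel g X φ i (φ p.proj, comp φ p.proj p.snd) := by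
  obtain ⟨v, h1, h2⟩ := exists_dx_dy hφ hp (fun i ↦ yCoord φ i p)
    fun i ↦ accel g X φ i (φ p.proj, comp φ p.proj p.snd)
  -- The field was chosen in the preferred chart; uniqueness identifies it with the vector built in
  -- φ.
  have h : hamField g X p = v := hamilton_unique hX fun w ↦
    (omegaTwo_hamField hX p w).trans (omegaTwo_eq_covector_hamiltonian hX hφ hp h1 h2 w).symm
  rw [h]
  exact ⟨h1 i, h2 i⟩

lemma contMDiff_hamField (hX : ContMDiff (𝓡 n) (𝓡 n).tangent ∞
      (fun x ↦ (⟨x, X x⟩ : TangentBundle (𝓡 n) M))) :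
    ContMDiff (𝓡 n).tangent (𝓡 n).tangent.tangent ∞ (fun p ↦
      (⟨p, hamField g X p⟩ : TangentBundle (𝓡 n).tangent (TangentBundle (𝓡 n) M))) := by
  intro p
  set φ := chartAt (Vec n) p.proj with hφdef
  have hφ : φ ∈ IsManifold.maximalAtlas (𝓡 n) ∞ M := chart_mem _
  have hp : p.proj ∈ φ.source := mem_chart_source _ _
  -- The field in coordinates. Near p, X_H is the image of the smooth section w ↦ (w, A w) under the
  -- tangent map of the inverse chart.
  set A : Vec n × Vec n → Vec n × Vec n := fun w ↦ (w.2, WithLp.toLp 2 fun i ↦ accel g X φ i w)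
  set w₀ : Vec n × Vec n := (φ p.proj, comp φ p.proj p.snd)
  have hw₀ : w₀.1 ∈ φ.target := φ.map_source hp
  have hA : ContDiffAt ℝ ∞ (fun w ↦ (w, A w)) w₀ :=
    contDiffAt_id.prodMk (contDiffAt_snd.prodMk
      (contDiffAt_euclidean.2 fun i ↦ contDiffAt_accel hX hφ hw₀ i))
  have h1 : ContMDiffAt (𝓡 n).tangent 𝓘(ℝ, Vec n × Vec n).tangent ∞
      (fun q : TangentBundle (𝓡 n) M ↦ (⟨(φ q.proj, comp φ q.proj q.snd),
        A (φ q.proj, comp φ q.proj q.snd)⟩ : TangentBundle 𝓘(ℝ, Vec n × Vec n) (Vec n × Vec n))) p :=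
    (contMDiff_mk_modelSpace.contMDiffAt.comp w₀ hA.contMDiffAt).comp p
      (contMDiffAt_tangentChart hφ hp)
  have h2 : ContMDiffOn 𝓘(ℝ, Vec n × Vec n) (𝓡 n).tangent ∞ (tangentChart hφ).symm
      (tangentChart hφ).target :=
    fun w hw ↦ (contMDiffAt_tangentChart_symm hφ hw).contMDiffWithinAt
  have h3 := ContMDiffOn.contMDiffAt_tangentMap h2 (tangentChart hφ).open_target (m := ∞) le_rfl
    (p := (⟨w₀, A w₀⟩ : TangentBundle 𝓘(ℝ, Vec n × Vec n) (Vec n × Vec n))) hw₀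
  refine (ContMDiffAt.comp p h3 h1).congr_of_eventuallyEq ?_
  filter_upwards [(φ.open_source.preimage
      (FiberBundle.continuous_proj (Vec n) (TangentSpace (𝓡 n)))).mem_nhds hp] with q hq
  refine (tangentBundle_mk_congr ((tangentChart hφ).left_inv hq) ?_).symm
  have h4 := DFunLike.congr_fun ((mdifferentiable_tangentChart hφ).symm_comp_deriv
    (x := q) hq) (hamField g X q)
  refine Eq.trans ?_ h4
  refine congrArg (mfderiv 𝓘(ℝ, Vec n × Vec n) (𝓡 n).tangent (tangentChart hφ).symm
    (tangentChart hφ q)) ?_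
  refine Eq.trans ?_ (mfderiv_tangentChart_apply hφ hq (hamField g X q)).symm
  have h5 (i : Fin n) := dx_dy_hamField (g := g) hX hφ hq i
  simp only [(h5 _).1, (h5 _).2]
  rfl

end Hamilton

/-! ### Integral curves of the Hamilton field and trajectories of the system. -/

section Curves

variable {n : ℕ} {M : Type*} [TopologicalSpace M] [ChartedSpace (Vec n) M] [IsManifold (𝓡 n) ∞ M]
  {g : SemiRiemannMetric n M} {X : (x : M) → TangentSpace (𝓡 n) x}
  {φ : OpenPartialHomeomorph M (Vec n)}

/-- The derivative of a function along a curve. -/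
lemma hasDerivAt_comp_curve {E : Type*} [NormedAddCommGroup E] [NormedSpace ℝ E] {H : Type*}
    [TopologicalSpace H] {I : ModelWithCorners ℝ E H} {N : Type*} [TopologicalSpace N]
    [ChartedSpace H N] {u : N → ℝ} {γ : ℝ → N} {t : ℝ} {v : TangentSpace I (γ t)}
    (hu : MDifferentiableAt I 𝓘(ℝ, ℝ) u (γ t))
    (hγ : HasMFDerivAt 𝓘(ℝ, ℝ) I γ t ((1 : ℝ →L[ℝ] ℝ).smulRight v)) :
    HasDerivAt (fun s ↦ u (γ s)) (covector I u (γ t) v) t := by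
  have h1 := hu.hasMFDerivAt.comp t hγ
  have e : (mfderiv I 𝓘(ℝ, ℝ) u (γ t)).comp ((1 : ℝ →L[ℝ] ℝ).smulRight v) =
      (1 : ℝ →L[ℝ] ℝ).smulRight (covector I u (γ t) v) :=
    ContinuousLinearMap.ext fun r ↦ map_smul (mfderiv I 𝓘(ℝ, ℝ) u (γ t)) r v
  have h : HasFDerivAt (fun s ↦ u (γ s)) ((1 : ℝ →L[ℝ] ℝ).smulRight (covector I u (γ t) v)) t :=
    (hasMFDerivAt_iff_hasFDerivAt.1 h1).congr_fderiv e
  simpa using h.hasDerivAt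

lemma smulRight_mfderiv_one {E : Type*} [NormedAddCommGroup E] [NormedSpace ℝ E] {H : Type*}
    [TopologicalSpace H] {I : ModelWithCorners ℝ E H} {N : Type*} [TopologicalSpace N]
    [ChartedSpace H N] {γ : ℝ → N} {t : ℝ} (hγ : MDifferentiableAt 𝓘(ℝ, ℝ) I γ t) :
    HasMFDerivAt 𝓘(ℝ, ℝ) I γ t
      ((1 : ℝ →L[ℝ] ℝ).smulRight (mfderiv 𝓘(ℝ, ℝ) I γ t (1 : ℝ) : TangentSpace I (γ t))) := by
  have e : ((1 : ℝ →L[ℝ] ℝ).smulRight (mfderiv 𝓘(ℝ, ℝ) I γ t (1 : ℝ) : TangentSpace I (γ t))) =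
      mfderiv 𝓘(ℝ, ℝ) I γ t := by
    refine ContinuousLinearMap.ext fun r ↦ ?_
    have h := map_smul (mfderiv 𝓘(ℝ, ℝ) I γ t) r (1 : ℝ)
    rw [smul_eq_mul, mul_one] at h
    exact h.symm
  rw [e]
  exact hγ.hasMFDerivAt

omit [IsManifold (𝓡 n) ∞ M] in
lemma comp_injective (hφ : φ ∈ IsManifold.maximalAtlas (𝓡 n) ∞ M) {x : M} (hx : x ∈ φ.source)
    {v w : TangentSpace (𝓡 n) x} (h : ∀ i, comp φ x v i = comp φ x w i) : v = w :=
  ((mdifferentiable_of_mem_maximalAtlas hφ).mfderiv_bijective hx).1 (PiLp.ext h)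

omit [IsManifold (𝓡 n) ∞ M] in
lemma hasDerivAt_chart_curve (hφ : φ ∈ IsManifold.maximalAtlas (𝓡 n) ∞ M) {c : ℝ → M} {t : ℝ}
    (hc : MDifferentiableAt 𝓘(ℝ, ℝ) (𝓡 n) c t) (ht : c t ∈ φ.source) (i : Fin n) :
    HasDerivAt (fun s ↦ φ (c s) i) (yCoord φ i (velocityLift c t)) t := by
  have h1 := (mdifferentiable_of_mem_maximalAtlas hφ).mdifferentiableAt ht
  have h3 : MDifferentiableAt (𝓡 n) 𝓘(ℝ, ℝ) (fun w : Vec n ↦ w i) (φ (c t)) :=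
    (EuclideanSpace.proj (𝕜 := ℝ) i).hasFDerivAt.hasMFDerivAt.mdifferentiableAt
  have h4 := mfderiv_comp (c t) h3 h1
  have h6 : mfderiv (𝓡 n) 𝓘(ℝ, ℝ) (fun w : Vec n ↦ w i) (φ (c t)) = EuclideanSpace.proj i :=
    (EuclideanSpace.proj (𝕜 := ℝ) i).hasFDerivAt.hasMFDerivAt.mfderiv
  have h5 := hasDerivAt_comp_curve (h3.comp (c t) h1) (smulRight_mfderiv_one hc)
  have h7 := (DFunLike.congr_fun h4 (mfderiv 𝓘(ℝ, ℝ) (𝓡 n) c t (1 : ℝ))).trans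
    (DFunLike.congr_fun h6 _)
  exact h5.congr_deriv h7

/-- The equation dx = y read invariantly: X_H is a second-order vector field. -/
lemma mfderiv_proj_hamField (hX : ContMDiff (𝓡 n) (𝓡 n).tangent ∞
      (fun x ↦ (⟨x, X x⟩ : TangentBundle (𝓡 n) M))) (p : TangentBundle (𝓡 n) M) :
    mfderiv (𝓡 n).tangent (𝓡 n) TotalSpace.proj p (hamField g X p) = p.snd := by
  have hp := mem_chart_source (Vec n) p.proj
  refine comp_injective (chart_mem p.proj) hp fun i ↦ ?_
  rw [← dx_apply (chart_mem p.proj) hp]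
  exact (dx_dy_hamField (g := g) hX (chart_mem p.proj) hp i).1

section IntegralCurve

variable {γ : ℝ → TangentBundle (𝓡 n) M} {s : Set ℝ}

lemma hasMFDerivAt_of_integral (hs : IsOpen s) (hγ : IsMIntegralCurveOn γ (hamField g X) s) {t : ℝ}
    (ht : t ∈ s) : HasMFDerivAt 𝓘(ℝ, ℝ) (𝓡 n).tangent γ t
      ((1 : ℝ →L[ℝ] ℝ).smulRight (hamField g X (γ t))) :=
  (hγ t ht).hasMFDerivAt (hs.mem_nhds ht)

lemma hasDerivAt_coord_integral (hX : ContMDiff (𝓡 n) (𝓡 n).tangent ∞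
      (fun x ↦ (⟨x, X x⟩ : TangentBundle (𝓡 n) M)))
    (hφ : φ ∈ IsManifold.maximalAtlas (𝓡 n) ∞ M) (hs : IsOpen s)
    (hγ : IsMIntegralCurveOn γ (hamField g X) s) {t : ℝ} (ht : t ∈ s)
    (hp : (γ t).proj ∈ φ.source) (i : Fin n) :
    HasDerivAt (fun u ↦ φ (γ u).proj i) (yCoord φ i (γ t)) t ∧
      HasDerivAt (fun u ↦ yCoord φ i (γ u))
        (accel g X φ i (φ (γ t).proj, comp φ (γ t).proj (γ t).snd)) t := by
  have h := dx_dy_hamField (g := g) hX hφ hp i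
  have hd := hasMFDerivAt_of_integral hs hγ ht
  rw [← h.1, ← h.2]
  exact ⟨hasDerivAt_comp_curve ((contMDiffAt_coord hφ hp i).mdifferentiableAt (by simp)) hd,
    hasDerivAt_comp_curve ((contMDiffAt_yCoord hφ hp i).mdifferentiableAt (by simp)) hd⟩

lemma integral_eq_velocityLift (hX : ContMDiff (𝓡 n) (𝓡 n).tangent ∞
      (fun x ↦ (⟨x, X x⟩ : TangentBundle (𝓡 n) M))) (hs : IsOpen s)
    (hγ : IsMIntegralCurveOn γ (hamField g X) s) {t : ℝ} (ht : t ∈ s) :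
    γ t = velocityLift (fun u ↦ (γ u).proj) t := by
  have hd := hasMFDerivAt_of_integral hs hγ ht
  have hπ : MDifferentiableAt (𝓡 n).tangent (𝓡 n)
      (TotalSpace.proj : TangentBundle (𝓡 n) M → M) (γ t) :=
    (contMDiff_proj (n := ∞) (TangentSpace (𝓡 n))).contMDiffAt.mdifferentiableAt (by simp)
  have h1 := (hπ.hasMFDerivAt.comp t hd).mfderiv
  have h2 : (mfderiv 𝓘(ℝ, ℝ) (𝓡 n) (fun u ↦ (γ u).proj) t (1 : ℝ) : Vec n) = (γ t).snd := by
    refine (DFunLike.congr_fun h1 (1 : ℝ)).trans ?_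
    refine Eq.trans ?_ (mfderiv_proj_hamField (g := g) hX (γ t))
    refine congrArg (mfderiv (𝓡 n).tangent (𝓡 n) TotalSpace.proj (γ t)) ?_
    exact one_smul ℝ (hamField g X (γ t))
  exact tangentBundle_mk_congr rfl h2.symm

/-- An integral curve is a priori only differentiable. But y' = `accel` (x, y) is continuous, so y
is C¹, and x' = y makes x of class C²; the same two equations are the system. -/
lemma isTrajectoryOn_of_integral (hX : ContMDiff (𝓡 n) (𝓡 n).tangent ∞
      (fun x ↦ (⟨x, X x⟩ : TangentBundle (𝓡 n) M))) (hs : IsOpen s)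
    (hγ : IsMIntegralCurveOn γ (hamField g X) s) :
    IsTrajectoryOn g X (fun u ↦ (γ u).proj) s := by
  have hcont : ContinuousOn γ s := fun t ht ↦ (hγ t ht).1
  have hO (φ : OpenPartialHomeomorph M (Vec n)) :
      IsOpen (s ∩ γ ⁻¹' (TotalSpace.proj ⁻¹' φ.source)) :=
    hcont.isOpen_inter_preimage hs (φ.open_source.preimage
      (FiberBundle.continuous_proj (Vec n) (TangentSpace (𝓡 n))))
  refine ⟨fun t ht ↦ ?_, fun t ht φ hφ hp i ↦ ?_⟩
  · set φ := chartAt (Vec n) (γ t).proj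
    have hφ : φ ∈ IsManifold.maximalAtlas (𝓡 n) ∞ M := chart_mem _
    have hp : (γ t).proj ∈ φ.source := mem_chart_source _ _
    set O := s ∩ γ ⁻¹' (TotalSpace.proj ⁻¹' φ.source)
    have hOo : IsOpen O := hO φ
    have htO : t ∈ O := ⟨ht, hp⟩
    have hd (i : Fin n) (u : ℝ) (hu : u ∈ O) :=
      hasDerivAt_coord_integral (g := g) hX hφ hs hγ hu.1 hu.2 i
    have hy (i : Fin n) : ContDiffOn ℝ 1 (fun u ↦ yCoord φ i (γ u)) O := by
      rw [show (1 : ℕ∞ω) = 0 + 1 from rfl, contDiffOn_succ_iff_deriv_of_isOpen hOo]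
      refine ⟨fun u hu ↦ (hd i u hu).2.differentiableAt.differentiableWithinAt, by simp, ?_⟩
      rw [contDiffOn_zero]
      refine ContinuousOn.congr (f := fun u ↦
        accel g X φ i (φ (γ u).proj, comp φ (γ u).proj (γ u).snd)) (fun u hu ↦ ?_)
        fun u hu ↦ (hd i u hu).2.deriv
      refine ContinuousAt.continuousWithinAt ?_
      have h1 : ContinuousAt γ u := (hcont u hu.1).continuousAt (hs.mem_nhds hu.1)
      have h2 := (contMDiffAt_tangentChart hφ hu.2).continuousAt
      have h3 := (contDiffAt_accel (g := g) hX hφ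
        (w := (φ (γ u).proj, comp φ (γ u).proj (γ u).snd)) (φ.map_source hu.2) i).continuousAt
      exact ContinuousAt.comp (f := fun u ↦ (φ (γ u).proj, comp φ (γ u).proj (γ u).snd)) h3
        (ContinuousAt.comp (f := γ) h2 h1)
    have hx (i : Fin n) : ContDiffOn ℝ 2 (fun u ↦ φ (γ u).proj i) O := by
      rw [show (2 : ℕ∞ω) = 1 + 1 from one_add_one_eq_two.symm,
        contDiffOn_succ_iff_deriv_of_isOpen hOo]
      exact ⟨fun u hu ↦ (hd i u hu).1.differentiableAt.differentiableWithinAt, by simp,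
        (hy i).congr fun u hu ↦ (hd i u hu).1.deriv⟩
    have hu : ContDiffAt ℝ 2 (fun u ↦ φ (γ u).proj) t :=
      contDiffAt_euclidean.2 fun i ↦ (hx i).contDiffAt (hOo.mem_nhds htO)
    have h1 : ContMDiffAt (𝓡 n) (𝓡 n) 2 φ.symm (φ (γ t).proj) :=
      (contMDiffAt_symm_of_mem_maximalAtlas hφ (φ.map_source hp)).of_le
        (WithTop.coe_le_coe.2 (le_top : (2 : ℕ∞) ≤ ⊤))
    refine ((ContMDiffAt.comp (f := fun u ↦ φ (γ u).proj) t h1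
      hu.contMDiffAt).congr_of_eventuallyEq ?_).contMDiffWithinAt
    filter_upwards [hOo.mem_nhds htO] with u hu
    exact (φ.left_inv hu.2).symm
  · have hd (i : Fin n) (u : ℝ) (hu : u ∈ s ∩ γ ⁻¹' (TotalSpace.proj ⁻¹' φ.source)) :=
      hasDerivAt_coord_integral (g := g) hX hφ hs hγ hu.1 hu.2 i
    have h1 (i : Fin n) : deriv (fun u ↦ φ (γ u).proj i) =ᶠ[nhds t] fun u ↦ yCoord φ i (γ u) := by
      filter_upwards [(hO φ).mem_nhds ⟨ht, hp⟩] with u hu using (hd i u hu).1.deriv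
    simp only [(h1 _).eq_of_nhds, (h1 i).deriv_eq, (hd i t ⟨ht, hp⟩).2.deriv]
    exact sub_add_cancel _ _

end IntegralCurve

lemma isMIntegralCurveOn_of_isTrajectoryOn (hX : ContMDiff (𝓡 n) (𝓡 n).tangent ∞
      (fun x ↦ (⟨x, X x⟩ : TangentBundle (𝓡 n) M))) {s : Set ℝ} (hs : IsOpen s) {c : ℝ → M}
    (hc : IsTrajectoryOn g X c s) : IsMIntegralCurveOn (velocityLift c) (hamField g X) s := by
  intro t ht
  set φ := chartAt (Vec n) (c t)
  have hφ : φ ∈ IsManifold.maximalAtlas (𝓡 n) ∞ M := chart_mem _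
  have hp : c t ∈ φ.source := mem_chart_source _ _
  have hc2 (u : ℝ) (hu : u ∈ s) : ContMDiffAt 𝓘(ℝ, ℝ) (𝓡 n) 2 c u :=
    hc.1.contMDiffAt (hs.mem_nhds hu)
  -- The lift is the tangent map of c applied to the unit field (u, 1), and one derivative is lost:
  -- C² gives C¹.
  have hv : MDifferentiableAt 𝓘(ℝ, ℝ) (𝓡 n).tangent (velocityLift (n := n) c) t := by
    have h1 := ContMDiffOn.contMDiffAt_tangentMap hc.1 hs (m := 1) (le_of_eq one_add_one_eq_two)
      (p := (⟨t, (1 : ℝ)⟩ : TangentBundle 𝓘(ℝ, ℝ) ℝ)) ht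
    have h2 : ContMDiffAt 𝓘(ℝ, ℝ) 𝓘(ℝ, ℝ).tangent 1
        (fun u : ℝ ↦ (⟨u, (1 : ℝ)⟩ : TangentBundle 𝓘(ℝ, ℝ) ℝ)) t :=
      contMDiff_mk_modelSpace.contMDiffAt.comp (f := fun u : ℝ ↦ (u, (1 : ℝ))) t
        (contDiff_id.prodMk contDiff_const).contMDiff.contMDiffAt
    exact (ContMDiffAt.comp t h1 h2).mdifferentiableAt one_ne_zero
  have hev : ∀ᶠ u in nhds t, u ∈ s ∧ c u ∈ φ.source :=
    Filter.Eventually.and (hs.mem_nhds ht)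
      ((hc2 t ht).continuousAt.preimage_mem_nhds (φ.open_source.mem_nhds hp))
  -- Needed on a neighbourhood of t, since x' is differentiated once more.
  have hx (i : Fin n) : deriv (fun u ↦ φ (c u) i) =ᶠ[nhds t]
      fun u ↦ yCoord φ i (velocityLift c u) := by
    filter_upwards [hev] with u hu using
      (hasDerivAt_chart_curve hφ ((hc2 u hu.1).mdifferentiableAt two_ne_zero) hu.2 i).deriv
  have hL := smulRight_mfderiv_one hv
  have key : (mfderiv 𝓘(ℝ, ℝ) (𝓡 n).tangent (velocityLift c) t (1 : ℝ) :
      TangentSpace (𝓡 n).tangent (velocityLift c t)) = hamField g X (velocityLift c t) := by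
    refine dx_dy_ext hφ (p := velocityLift c t) hp (fun i ↦ ?_) fun i ↦ ?_
    · have h1 := hasDerivAt_comp_curve ((contMDiffAt_coord hφ (p := velocityLift c t) hp
        i).mdifferentiableAt (by simp)) hL
      refine h1.deriv.symm.trans ?_
      rw [(dx_dy_hamField hX hφ (p := velocityLift c t) hp i).1]
      exact (hx i).eq_of_nhds
    · have h1 := hasDerivAt_comp_curve ((contMDiffAt_yCoord hφ (p := velocityLift c t) hp
        i).mdifferentiableAt (by simp)) hL
      refine h1.deriv.symm.trans ?_
      rw [(dx_dy_hamField hX hφ (p := velocityLift c t) hp i).2, ← (hx i).deriv_eq]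
      have h2 := hc.2 t ht φ hφ hp i
      simp only [(hx _).eq_of_nhds] at h2
      exact eq_sub_of_add_eq h2
  rw [key] at hL
  exact hL.hasMFDerivWithinAt

end Curves

end GeomDyn

end

theorem mainTheorem5 {n : ℕ} {M : Type*} [TopologicalSpace M]
    [ChartedSpace (GeomDyn.Vec n) M] [IsManifold (𝓡 n) ∞ M]
    (g : GeomDyn.SemiRiemannMetric n M)
    (X : (x : M) → TangentSpace (𝓡 n) x)
    (hX : ContMDiff (𝓡 n) (𝓡 n).tangent ∞ (fun x ↦ (⟨x, X x⟩ : TangentBundle (𝓡 n) M))) :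
    -- `ω` is a 2-form, and the local expressions of `Ω₂` and `η₂` hold in every chart
    (∀ φ ∈ IsManifold.maximalAtlas (𝓡 n) ∞ M,
      (∀ z ∈ φ.target, ∀ i j, GeomDyn.omegaLow g X φ i j z = -GeomDyn.omegaLow g X φ j i z) ∧
      ∀ p : TangentBundle (𝓡 n) M, p.proj ∈ φ.source →
        GeomDyn.omegaTwo g X p = GeomDyn.omegaTwoInChart g X φ p ∧
        GeomDyn.etaTwo g X p = GeomDyn.etaTwoInChart g X φ p) ∧
    -- `Ω₂` is a symplectic form and `Ω₂ = -dη₂`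
    GeomDyn.IsSymplectic (𝓡 n).tangent (GeomDyn.omegaTwo g X) ∧
    GeomDyn.IsSmoothForm (𝓡 n).tangent (GeomDyn.etaTwo g X) ∧
    (∀ p, GeomDyn.omegaTwo g X p = -GeomDyn.extDerivForm (𝓡 n).tangent (GeomDyn.etaTwo g X) p) ∧
    -- the Hamiltonian is smooth and has a unique Hamilton gradient, which is smooth
    ContMDiff (𝓡 n).tangent 𝓘(ℝ, ℝ) ∞ (GeomDyn.hamiltonian g X) ∧
    ∃ V : (p : TangentBundle (𝓡 n) M) → TangentSpace (𝓡 n).tangent p,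
      (∀ W : (p : TangentBundle (𝓡 n) M) → TangentSpace (𝓡 n).tangent p,
        GeomDyn.IsHamiltonGradient (𝓡 n).tangent (GeomDyn.omegaTwo g X)
          (GeomDyn.hamiltonian g X) W ↔ W = V) ∧
      ContMDiff (𝓡 n).tangent (𝓡 n).tangent.tangent ∞
        (fun p ↦ (⟨p, V p⟩ : TangentBundle (𝓡 n).tangent (TangentBundle (𝓡 n) M))) ∧
      -- the solutions of the Hamilton equations are exactly the lifts of the trajectories
      (∀ (s : Set ℝ), IsOpen s →
        (∀ c : ℝ → M, GeomDyn.IsTrajectoryOn g X c s ↔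
          IsMIntegralCurveOn (GeomDyn.velocityLift c) V s) ∧
        (∀ γ : ℝ → TangentBundle (𝓡 n) M, IsMIntegralCurveOn γ V s →
          (∀ t ∈ s, γ t = GeomDyn.velocityLift (fun u ↦ (γ u).proj) t) ∧
          GeomDyn.IsTrajectoryOn g X (fun u ↦ (γ u).proj) s)) := by
  obtain ⟨hΩ, hη⟩ := GeomDyn.isSymplectic_omegaTwo (g := g) hX
  refine ⟨fun φ hφ ↦ ⟨fun z hz i j ↦ GeomDyn.omegaLow_antisymm hφ hz i j, fun p hp ↦
      ⟨GeomDyn.omegaTwo_eq hX hφ hp, GeomDyn.etaTwo_eq hφ hp⟩⟩, hΩ, hη,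
    GeomDyn.omegaTwo_eq_neg_extDerivForm hX, GeomDyn.contMDiff_hamiltonian hX,
    GeomDyn.hamField g X, GeomDyn.isHamiltonGradient_iff hX, GeomDyn.contMDiff_hamField hX,
    fun s hs ↦ ⟨fun c ↦ ⟨GeomDyn.isMIntegralCurveOn_of_isTrajectoryOn hX hs,
      -- Applied to γ = `velocityLift c`, whose projection is c by definition; regularity of c need
      -- not be assumed here.
      GeomDyn.isTrajectoryOn_of_integral hX hs⟩, fun γ hγ ↦
      ⟨fun t ht ↦ GeomDyn.integral_eq_velocityLift hX hs hγ ht,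
        GeomDyn.isTrajectoryOn_of_integral hX hs hγ⟩⟩⟩
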